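/- Let $\mathbb R^{3,1}$ be $\mathbb R^4$ with the Lorentzian product $x\cdot y=x_1y_1+x_2y_2+x_3y_3-x_4y_4$, let $\mathbb H^3=\{x: x\cdot x=-1,\ x_4>0\}$ with the hyperbolic distance $d$ given by $\cosh d(x,y)=-x\cdot y$, and let $SO(3,1)^\uparrow\cong PSL(2,\mathbb C)$ be the group of linear automorphisms of determinant $1$ of $\mathbb R^{3,1}$ which preserve the product and the future light cone $\{x\cdot x<0,\ x_4>0\}$. An element $A\in SO(3,1)^\uparrow$ is loxodromic if it has, up to multiples, exactly two eigenvectors in $\{v: v\cdot v=0,\ v_4>0\}$ and the corresponding eigenvalues $\lambda,\lambda^{-1}$ are different from $1$. A hyperbolic polyhedron in $\mathbb H^3$ is an intersection of finitely many open and closed half-spaces; its faces are the nonempty subsets obtained by converting some (possibly none) of its non-strict defining inequalities to equalities, and its dimension is that of its projective span. A hyperbolic polyhedral complex in $\mathbb H^3$ is a set of nonempty polyhedra which contains with every polyhedron all of its faces; $c$ is incident to $c'$ if $c$ is a face of $c'$; a facet is a member which is not a proper face of another member. The residue of $c$ consists of all faces of all members to which $c$ is incident. The nerve of a complex has the facets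 as its vertices, and $k+1$ distinct facets span a $k$-simplex if some $(3-k)$-dimensional member of the complex is a face of all of them. A complex is simple if it is nonempty, all its facets have dimension $3$, and for every $k=0,\dots,3$ and every $k$-dimensional member $c$, the nerve of the residue of $c$ is isomorphic to the simplicial complex of all faces of a $(3-k)$-dimensional simplex. For a subgroup $\Gamma<SO(3,1)^\uparrow$ and $x\in\mathbb H^3$, the Dirichlet tiling $\mathcal D_x(\Gamma)$ consists of the tiles $D_{\gamma x}=\{p\in\mathbb H^3: d(p,\gamma x)\le d(p,\alpha x)\ \text{for all }\alpha\in\Gamma\}$, $\gamma\in\Gamma$, and of all their faces. **Theorem.** Let $A\in SO(3,1)^\uparrow$ be loxodromic and let $\langle A\rangle$ be the cyclic group generated by $A$. Then for every $x\in\mathbb H^3$ the Dirichlet tiling $\mathcal D_x(\langle A\rangle)$ is a hyperbolic polyhedral complex (in particular, every tile is a polyhedron with finitely many faces), and this complex is simple. -/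

import Mathlib

/-- Vectors of the Lorentzian space `ℝ^{n,1}`; the last coordinate is the time coordinate. -/
abbrev LVec (n : ℕ) : Type := Fin (n + 1) → ℝ

/-- The Lorentzian inner product of signature `(n, 1)`. -/
def lorentz {n : ℕ} (x y : LVec n) : ℝ :=
  (∑ i : Fin n, x i.castSucc * y i.castSucc) - x (Fin.last n) * y (Fin.last n)

/-- The (open) future light cone. -/
def futureCone (n : ℕ) : Set (LVec n) :=
  {x | lorentz x x < 0 ∧ 0 < x (Fin.last n)}

/-- The nonzero vectors of the boundary of the future light cone. -/
def futureNull (n : ℕ) : Set (LVec n) :=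
  {x | lorentz x x = 0 ∧ 0 < x (Fin.last n)}

/-- Hyperbolic `n`-space: the future sheet of the hyperboloid `x · x = -1`. -/
def Hyp (n : ℕ) : Set (LVec n) :=
  {x | lorentz x x = -1 ∧ 0 < x (Fin.last n)}

/-- The hyperbolic distance on `Hyp n`, i.e. `cosh (d(x, y)) = -(x · y)`. -/
noncomputable def hdist {n : ℕ} (x y : LVec n) : ℝ :=
  Real.arcosh (-(lorentz x y))

/-- The group `O(n,1)^↑` of linear automorphisms of `ℝ^{n,1}` which preserve the Lorentzian
inner product and the future light cone. -/
def Oup (n : ℕ) : Subgroup (GL (Fin (n + 1)) ℝ) where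
  carrier := {A | (∀ x y : LVec n,
      lorentz ((A : Matrix (Fin (n + 1)) (Fin (n + 1)) ℝ).mulVec x)
        ((A : Matrix (Fin (n + 1)) (Fin (n + 1)) ℝ).mulVec y) = lorentz x y) ∧
    ∀ x : LVec n,
      (A : Matrix (Fin (n + 1)) (Fin (n + 1)) ℝ).mulVec x ∈ futureCone n ↔ x ∈ futureCone n}
  one_mem' := by simp
  mul_mem' := by
    rintro A B ⟨hA, hA'⟩ ⟨hB, hB'⟩
    refine ⟨fun x y => ?_, fun x => ?_⟩
    · rw [Units.val_mul, ← Matrix.mulVec_mulVec, ← Matrix.mulVec_mulVec, hA, hB]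
    · rw [Units.val_mul, ← Matrix.mulVec_mulVec, hA', hB']
  inv_mem' := by
    rintro A ⟨hA, hA'⟩
    have key : ∀ x : LVec n, (A : Matrix (Fin (n + 1)) (Fin (n + 1)) ℝ).mulVec
        (((A⁻¹ : GL (Fin (n + 1)) ℝ) : Matrix (Fin (n + 1)) (Fin (n + 1)) ℝ).mulVec x) = x := by
      intro x
      rw [Matrix.mulVec_mulVec, ← Units.val_mul, mul_inv_cancel, Units.val_one, Matrix.one_mulVec]
    refine ⟨fun x y => ?_, fun x => ?_⟩
    · rw [← hA, key, key]
    · rw [← hA', key]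

/-- The group `SO(n,1)^↑`. -/
def SOup (n : ℕ) : Subgroup (GL (Fin (n + 1)) ℝ) :=
  Oup n ⊓ (Matrix.GeneralLinearGroup.det (n := Fin (n + 1)) (R := ℝ)).ker

/-- Loxodromic elements of `O(n,1)^↑`: there are, up to multiples, exactly two eigenvectors in the
boundary of the future light cone, and their eigenvalues `μ`, `μ⁻¹` are different from `1`. -/
def IsLoxodromic {n : ℕ} (A : GL (Fin (n + 1)) ℝ) : Prop :=
  A ∈ Oup n ∧
  ∃ e₁ ∈ futureNull n, ∃ e₂ ∈ futureNull n, ∃ μ : ℝ,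
    LinearIndependent ℝ ![e₁, e₂] ∧ μ ≠ 1 ∧
    (A : Matrix (Fin (n + 1)) (Fin (n + 1)) ℝ).mulVec e₁ = μ • e₁ ∧
    (A : Matrix (Fin (n + 1)) (Fin (n + 1)) ℝ).mulVec e₂ = μ⁻¹ • e₂ ∧
    ∀ v ∈ futureNull n, ∀ ν : ℝ,
      (A : Matrix (Fin (n + 1)) (Fin (n + 1)) ℝ).mulVec v = ν • v →
      ∃ c : ℝ, v = c • e₁ ∨ v = c • e₂

/-- `P` is the intersection of the closed half-spaces `{u · p ≤ 0}`, `u ∈ S`, and of the open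
half-spaces `{u · p < 0}`, `u ∈ T`, of hyperbolic `n`-space (`u` has positive Lorentzian norm, so
that `u^⊥` is a hyperbolic hyperplane). -/
def IsPresentedBy {n : ℕ} (S T : Finset (LVec n)) (P : Set (LVec n)) : Prop :=
  (∀ u ∈ S, 0 < lorentz u u) ∧ (∀ u ∈ T, 0 < lorentz u u) ∧
  P = {p | p ∈ Hyp n ∧ (∀ u ∈ S, lorentz u p ≤ 0) ∧ ∀ u ∈ T, lorentz u p < 0}

/-- A convex hyperbolic polyhedron. -/
def IsPolyhedron {n : ℕ} (P : Set (LVec n)) : Prop :=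
  ∃ S T : Finset (LVec n), IsPresentedBy S T P

/-- `F` is a (nonempty) face of the polyhedron `P`: it is obtained by converting some of the
non-strict inequalities which define `P` to equalities. In particular, `P` is a face of `P`. -/
def IsFace {n : ℕ} (F P : Set (LVec n)) : Prop :=
  F.Nonempty ∧ ∃ S T S' : Finset (LVec n), IsPresentedBy S T P ∧ S' ⊆ S ∧
    F = {p | p ∈ P ∧ ∀ u ∈ S', lorentz u p = 0}

/-- The polyhedron `P` has dimension `k`, i.e. its projective span has dimension `k`. -/
def HasDim {n : ℕ} (P : Set (LVec n)) (k : ℕ) : Prop :=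
  Module.finrank ℝ (Submodule.span ℝ P) = k + 1

/-- Hyperbolic polyhedral complexes whose objects are (nonempty) polyhedra in hyperbolic `n`-space
and whose morphisms `c → c'` (the incidence maps) are the inclusions of `c` as a face of `c'`.
Between two objects there is at most one such morphism. -/
def IsPolyhedralComplex {n : ℕ} (C : Set (Set (LVec n))) : Prop :=
  (∀ c ∈ C, IsPolyhedron c ∧ c.Nonempty) ∧ ∀ c ∈ C, ∀ F, IsFace F c → F ∈ C

/-- The facets of a complex: the faces which are not proper faces of other faces. -/
def facets {n : ℕ} (C : Set (Set (LVec n))) : Set (Set (LVec n)) :=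
  {c | c ∈ C ∧ ∀ c' ∈ C, IsFace c c' → c = c'}

/-- The complex is pure of dimension `d`. -/
def IsPureOfDim {n : ℕ} (C : Set (Set (LVec n))) (d : ℕ) : Prop :=
  C.Nonempty ∧ ∀ c ∈ facets C, HasDim c d

/-- The residue of `c` in `C`: the smallest subcomplex of `C` containing all `c'` such that there is
an incidence map `c → c'`. -/
def residue {n : ℕ} (C : Set (Set (LVec n))) (c : Set (LVec n)) : Set (Set (LVec n)) :=
  {d | d ∈ C ∧ ∃ c' ∈ C, IsFace c c' ∧ IsFace d c'}

/-- The simplices of the nerve of a complex of pure dimension `n`: distinct facets `c₀, …, c_k` span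
a `k`-simplex iff some face of dimension `n - k` is incident to all of them. -/
def nerve {n : ℕ} (C : Set (Set (LVec n))) : Set (Finset (Set (LVec n))) :=
  {s | (∀ c ∈ s, c ∈ facets C) ∧
    ∃ k j : ℕ, s.card = k + 1 ∧ j + k = n ∧ ∃ d ∈ C, HasDim d j ∧ ∀ c ∈ s, IsFace d c}

/-- The simplicial complex with vertex set `V` and set of simplices `K` is isomorphic to the
complex of all (nonempty) faces of the simplex of dimension `m`. -/
def IsoToSimplex {α : Type*} (V : Set α) (K : Set (Finset α)) (m : ℕ) : Prop :=
  ∃ φ : Fin (m + 1) → α, Function.Injective φ ∧ Set.range φ = V ∧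
    ∀ s : Finset α, s ∈ K ↔ s.Nonempty ∧ (s : Set α) ⊆ Set.range φ

/-- Simple hyperbolic polyhedral complexes (of dimension `n`, in hyperbolic `n`-space): the complex
is pure of dimension `n`, and the nerve of the residue of each `k`-face is a simplex of dimension
`n - k`. -/
def IsSimpleComplex {n : ℕ} (C : Set (Set (LVec n))) : Prop :=
  IsPolyhedralComplex C ∧ IsPureOfDim C n ∧
  ∀ k ≤ n, ∀ c ∈ C, HasDim c k →
    IsoToSimplex (facets (residue C c)) (nerve (residue C c)) (n - k)

/-- The Voronoi cell of `y` with respect to `Y`. -/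
def voronoiCell {n : ℕ} (Y : Set (LVec n)) (y : LVec n) : Set (LVec n) :=
  {p | p ∈ Hyp n ∧ ∀ y' ∈ Y, hdist p y ≤ hdist p y'}

/-- The Voronoi complex of `Y`: the Voronoi cells and all their faces. -/
def voronoiComplex {n : ℕ} (Y : Set (LVec n)) : Set (Set (LVec n)) :=
  {F | ∃ y ∈ Y, F = voronoiCell Y y ∨ IsFace F (voronoiCell Y y)}

/-- The Dirichlet tiling `𝒟_x(Γ)`, as a complex: the Voronoi complex of the orbit `Γ · x`. -/
def dirichletComplex {n : ℕ} (Γ : Subgroup (GL (Fin (n + 1)) ℝ)) (x : LVec n) :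
    Set (Set (LVec n)) :=
  voronoiComplex {y | ∃ γ ∈ Γ, y = (γ : Matrix (Fin (n + 1)) (Fin (n + 1)) ℝ).mulVec x}

/-!
Let `L > 0` be the translation length and `θ` the rotation angle of `A`. In a frame of `ℝ^{3,1}`
adapted to the axis of `A` (`exists_isAxisFrame`), the function `k ↦ cosh d(p, Aᵏ x)` has the form
`C cosh (L k - b) - γ cos (k θ + φ)` with `0 ≤ γ < C` (`IsAxisFrame.exists_profile`). The tiles
which contain `p` correspond to the minima of this function on `ℤ`.

*Reduction to general position.* Every tile is cut out by finitely many bisectors, because an orbit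
point can be nearer to `p` than its two neighbours only at a bounded height over `p`
(`exists_profile_bound`). For any discrete set of sites with this property, the Voronoi complex is a
polyhedral complex in which incidence is inclusion (`isFace_iff_subset`). If, moreover, the sites
nearest to any given point are linearly independent, then the intersection of `m` cells has
codimension `m - 1` as soon as it is nonempty (`hasDim_commonCell`), and the complex is simple
(`isSimpleComplex_voronoiComplex`).

*Independence of the nearest orbit points* (`eq_zero_of_relation`). Three orbit points are always
affinely independent, by a look at their coordinates `exp (± L k)`. So two things have to be
excluded: five nearest points, and four dependent ones.

* If `γ (1 - cos θ) ≤ C (cosh L - 1)`, then the function is convex on `ℤ`, and it has at most three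
  minima (`profile_minima_close`).
* Otherwise its minimum is less than `C + γ` (`exists_profile_lt`): the largest ball around `p`
  without orbit points in its interior contains no full circle of the cylinder around the axis on
  which the orbit lies. Unrolled to the plane, the part of the cylinder in the ball is a strictly
  convex region (`strictConvexOn_strip`), whose interior contains no point of the lattice formed by
  the lifts of the orbit. Hence no two nearest points are congruent modulo `2` in the lattice, which
  leaves at most four of them, and four of them form a parallelogram (`exists_parallelogram`).

Finally, let four nearest points with indices `k, k + a, l, l + a` be dependent. The relation
persists under translation by powers of `A`; its signs and the translation by `Aᵃ` show that the
points with indices `k + 2a` and `l + 2a` are nearest points as well, and by induction there are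
infinitely many of them, a contradiction (`false_of_parallelogram_relation`).
-/

/-! ### A strictly convex function on a strip -/

theorem convexOn_sinh_Ici : ConvexOn ℝ (Set.Ici 0) Real.sinh := by
  refine convexOn_of_deriv2_nonneg (convex_Ici 0) Real.continuous_sinh.continuousOn
    Real.differentiable_sinh.differentiableOn ?_ ?_
  · rw [Real.deriv_sinh]
    exact Real.differentiable_cosh.differentiableOn
  · intro x hx
    rw [interior_Ici] at hx
    simp only [Function.iterate_succ, Function.iterate_zero, Function.comp_apply, id,
      Real.deriv_sinh, Real.deriv_cosh]
    exact Real.sinh_nonneg_iff.2 (le_of_lt hx)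

theorem convexOn_abs_sinh : ConvexOn ℝ Set.univ fun x : ℝ => |Real.sinh x| := by
  refine ⟨convex_univ, fun x _ y _ a b ha hb hab => ?_⟩
  simp only [Real.abs_sinh, smul_eq_mul]
  have h1 : |a * x + b * y| ≤ a * |x| + b * |y| := by
    refine (abs_add_le _ _).trans ?_
    rw [abs_mul, abs_mul, abs_of_nonneg ha, abs_of_nonneg hb]
  refine (Real.sinh_strictMono.monotone h1).trans ?_
  exact convexOn_sinh_Ici.2 (abs_nonneg x) (abs_nonneg y) ha hb hab

theorem strictConvexOn_sqrt_sq_add {D : ℝ} (hD : 0 < D) :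
    StrictConvexOn ℝ Set.univ fun x : ℝ => √(x ^ 2 + D) := by
  refine ⟨convex_univ, fun x _ y _ hxy a b ha hb hab => ?_⟩
  simp only [smul_eq_mul]
  have hp : 0 < √(x ^ 2 + D) := Real.sqrt_pos.2 (by positivity)
  have hq : 0 < √(y ^ 2 + D) := Real.sqrt_pos.2 (by positivity)
  have hp2 : √(x ^ 2 + D) ^ 2 = x ^ 2 + D := Real.sq_sqrt (by positivity)
  have hq2 : √(y ^ 2 + D) ^ 2 = y ^ 2 + D := Real.sq_sqrt (by positivity)
  set p := √(x ^ 2 + D)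
  set q := √(y ^ 2 + D)
  -- the strict Cauchy-Schwarz inequality for `(x, √D)` and `(y, √D)`
  have hcs : x * y + D < p * q := by
    refine lt_of_pow_lt_pow_left₀ 2 (by positivity) ?_
    rw [mul_pow, hp2, hq2]
    nlinarith [mul_pos hD (pow_pos (abs_pos.2 (sub_ne_zero.2 hxy)) 2), sq_abs (x - y)]
  rw [Real.sqrt_lt' (by positivity)]
  have hD' : D = (a + b) ^ 2 * D := by rw [hab]; ring
  have hexp : (a * p + b * q) ^ 2 = a ^ 2 * p ^ 2 + b ^ 2 * q ^ 2 + 2 * (a * b * (p * q)) := by ring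
  rw [hexp, hp2, hq2]
  linarith [mul_lt_mul_of_pos_left hcs (mul_pos ha hb)]

/-- On the strip, the region where this function is negative is the part of a metric ball centred
at a point off the axis, cut out on an equidistant cylinder around the axis (with coordinates the
height and the angle), provided that the ball does not contain a whole circle of the cylinder. -/
theorem strictConvexOn_strip {D s : ℝ} (hD : 0 < D) (hs : 0 < s) :
    StrictConvexOn ℝ (Set.univ ×ˢ Set.Icc (-Real.pi) Real.pi : Set (ℝ × ℝ))
      fun z => √(Real.sinh (z.1 / 2) ^ 2 + D) - s * Real.cos (z.2 / 2) := by
  refine ⟨convex_univ.prod (convex_Icc _ _), ?_⟩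
  rintro ⟨u, v⟩ ⟨-, hv⟩ ⟨u', v'⟩ ⟨-, hv'⟩ hne a b ha hb hab
  simp only [Set.mem_Icc] at hv hv'
  simp only [Prod.smul_mk, Prod.mk_add_mk, smul_eq_mul]
  have hu1 : (a * u + b * u') / 2 = a * (u / 2) + b * (u' / 2) := by ring
  have hv1 : (a * v + b * v') / 2 = a * (v / 2) + b * (v' / 2) := by ring
  rw [hu1, hv1]
  have hI : ∀ w : ℝ, -Real.pi ≤ w ∧ w ≤ Real.pi → w / 2 ∈ Set.Icc (-(Real.pi / 2)) (Real.pi / 2) :=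
    fun w hw => ⟨by linarith [hw.1], by linarith [hw.2]⟩
  have hB : |Real.sinh (a * (u / 2) + b * (u' / 2))| ≤
      a * |Real.sinh (u / 2)| + b * |Real.sinh (u' / 2)| :=
    convexOn_abs_sinh.2 trivial trivial ha.le hb.le hab
  have hmono : ∀ {x y : ℝ}, |x| ≤ y → √(x ^ 2 + D) ≤ √(y ^ 2 + D) := by
    intro x y hxy
    apply Real.sqrt_le_sqrt
    have := sq_abs x
    nlinarith [abs_nonneg x]
  have hsq := hmono hB
  have hconv : √((a * |Real.sinh (u / 2)| + b * |Real.sinh (u' / 2)|) ^ 2 + D) ≤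
      a * √(Real.sinh (u / 2) ^ 2 + D) + b * √(Real.sinh (u' / 2) ^ 2 + D) := by
    have := (strictConvexOn_sqrt_sq_add hD).convexOn.2 (x := |Real.sinh (u / 2)|) trivial
      (y := |Real.sinh (u' / 2)|) trivial ha.le hb.le hab
    simpa only [smul_eq_mul, sq_abs] using this
  by_cases hvv : v = v'
  · subst hvv
    have huu : u ≠ u' := fun h => hne (by rw [h])
    have e : a * (v / 2) + b * (v / 2) = v / 2 := by rw [← add_mul, hab, one_mul]
    rw [e]
    have key : √(Real.sinh (a * (u / 2) + b * (u' / 2)) ^ 2 + D) <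
        a * √(Real.sinh (u / 2) ^ 2 + D) + b * √(Real.sinh (u' / 2) ^ 2 + D) := by
      by_cases hX : |Real.sinh (u / 2)| = |Real.sinh (u' / 2)|
      · have h2 : Real.sinh (u / 2) ^ 2 = Real.sinh (u' / 2) ^ 2 := by
          rw [← sq_abs, hX, sq_abs]
        have huv : |u / 2| = |u' / 2| := by
          rw [Real.abs_sinh, Real.abs_sinh] at hX
          exact Real.sinh_injective hX
        have hopp : u' = -u := by
          rcases abs_eq_abs.1 huv with h | h
          · exact absurd (by linarith) huu
          · linarith
        have hu0 : u ≠ 0 := by rintro rfl; simp at hopp; exact huu hopp.symm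
        rw [← h2, ← add_mul, hab, one_mul]
        apply Real.sqrt_lt_sqrt (by positivity)
        have hlt : |a * (u / 2) + b * (u' / 2)| < |u / 2| := by
          have : a * (u / 2) + b * (u' / 2) = (a - b) * (u / 2) := by rw [hopp]; ring
          rw [this, abs_mul]
          have h1 : |a - b| < 1 := by rw [abs_lt]; constructor <;> linarith
          have h3 : 0 < |u / 2| := abs_pos.2 (by simpa using hu0)
          nlinarith
        have hsl := Real.sinh_strictMono hlt
        rw [← Real.abs_sinh, ← Real.abs_sinh] at hsl
        have h4 := sq_lt_sq.2 hsl
        linarith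
      · have := (strictConvexOn_sqrt_sq_add hD).2 (x := |Real.sinh (u / 2)|) trivial
          (y := |Real.sinh (u' / 2)|) trivial hX ha hb hab
        simp only [smul_eq_mul, sq_abs] at this
        exact hsq.trans_lt this
    linear_combination key + s * Real.cos (v / 2) * hab
  · have hcos : a * Real.cos (v / 2) + b * Real.cos (v' / 2) <
        Real.cos (a * (v / 2) + b * (v' / 2)) :=
      strictConcaveOn_cos_Icc.2 (hI v hv) (hI v' hv') (fun h => hvv (by linarith)) ha hb hab
    have := mul_lt_mul_of_pos_left hcos hs
    linarith

/-! ### Lattice points on the boundary of a strictly convex lattice-free region -/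

/-- The standard embedding of `ℤ × ℤ` in the plane. -/
def latticePt (z : ℤ × ℤ) : ℝ × ℝ := (z.1, z.2)

theorem latticePt_injective : Function.Injective latticePt := by
  rintro ⟨a, b⟩ ⟨c, d⟩ h
  simpa [latticePt] using h

/-- Two distinct zeros of `Ψ` at lattice points are not congruent modulo `2`, as `Ψ` would be
negative at their midpoint. -/
theorem not_congr_mod_two {Ψ : ℝ × ℝ → ℝ} {K : Set (ℝ × ℝ)} (hΨ : StrictConvexOn ℝ K Ψ)
    (hpos : ∀ z : ℤ × ℤ, latticePt z ∈ K → 0 ≤ Ψ (latticePt z))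
    {P Q : ℤ × ℤ} (hP : latticePt P ∈ K) (hQ : latticePt Q ∈ K)
    (hP0 : Ψ (latticePt P) = 0) (hQ0 : Ψ (latticePt Q) = 0) (hne : P ≠ Q)
    (h : ((P.1 : ZMod 2), (P.2 : ZMod 2)) = ((Q.1 : ZMod 2), (Q.2 : ZMod 2))) : False := by
  simp only [Prod.mk.injEq, ZMod.intCast_eq_intCast_iff_dvd_sub] at h
  obtain ⟨⟨x, hx⟩, ⟨y, hy⟩⟩ := h
  have hne' : latticePt P ≠ latticePt Q := fun h => hne (latticePt_injective h)
  have hmid : latticePt (P.1 + x, P.2 + y) =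
      (1 / 2 : ℝ) • latticePt P + (1 / 2 : ℝ) • latticePt Q := by
    have hx' : (Q.1 : ℝ) - P.1 = 2 * x := by exact_mod_cast hx
    have hy' : (Q.2 : ℝ) - P.2 = 2 * y := by exact_mod_cast hy
    simp only [latticePt, Prod.smul_mk, Prod.mk_add_mk, smul_eq_mul, Prod.mk.injEq]
    push_cast
    constructor <;> linarith
  have hK : latticePt (P.1 + x, P.2 + y) ∈ K := by
    rw [hmid]; exact hΨ.1 hP hQ (by norm_num) (by norm_num) (by norm_num)
  have h1 := hpos _ hK
  have hsc := hΨ.2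
  have h2 := hsc hP hQ hne' (a := 1 / 2) (b := 1 / 2) (by norm_num) (by norm_num) (by norm_num)
  rw [← hmid, hP0, hQ0] at h2
  simp at h2
  linarith

/-- The convex hull of a set on which a strictly convex function is nonpositive contains no further
points at which the function is nonnegative. -/
theorem StrictConvexOn.mem_of_mem_convexHull {E : Type*} [AddCommGroup E] [Module ℝ E] {Ψ : E → ℝ}
    {K : Set E} (hΨ : StrictConvexOn ℝ K Ψ) {Z : Set E} (hZ : ∀ z ∈ Z, z ∈ K ∧ Ψ z ≤ 0) {p : E}
    (hp : p ∈ convexHull ℝ Z) (hp0 : p ∈ K → 0 ≤ Ψ p) : p ∈ Z := by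
  have hsub : convexHull ℝ Z ⊆ {z | z ∈ K ∧ Ψ z ≤ 0 ∧ (Ψ z = 0 → z ∈ Z)} := by
    refine convexHull_min (fun z hz => ⟨(hZ z hz).1, (hZ z hz).2, fun _ => hz⟩) ?_
    intro x hx' y hy' a b ha hb hab
    rcases ha.eq_or_lt with rfl | ha
    · obtain rfl : b = 1 := by linarith
      simpa using hy'
    rcases hb.eq_or_lt with rfl | hb
    · obtain rfl : a = 1 := by linarith
      simpa using hx'
    by_cases hxy : x = y
    · subst hxy
      rwa [← add_smul, hab, one_smul]
    obtain ⟨hxK, hx0, -⟩ := hx'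
    obtain ⟨hyK, hy0, -⟩ := hy'
    have hlt := hΨ.2 hxK hyK hxy ha hb hab
    have hneg : Ψ (a • x + b • y) < 0 := by
      refine hlt.trans_le ?_
      simp only [smul_eq_mul]
      nlinarith
    exact ⟨hΨ.1 hxK hyK ha.le hb.le hab, hneg.le, fun h => absurd h hneg.ne⟩
  obtain ⟨h1, h2, h3⟩ := hsub hp
  exact h3 (le_antisymm h2 (hp0 h1))

/-- Let the diagonals `P₁P₃` and `P₂P₄` of a quadrilateral with vertices at zeros of `Ψ` cross, such
that the crossing point is nearer to `P₁` than to `P₃` and nearer to `P₂` than to `P₄`, and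
relatively nearer to `P₁`. Then the reflection `X` of `P₁` in the centroid of the vertices is in the
quadrilateral, so `Ψ` is negative there unless `X` is a vertex. -/
theorem parallelogram_of_crossing_aux {E : Type*} [AddCommGroup E] [Module ℝ E] {Ψ : E → ℝ}
    {K : Set E} (hΨ : StrictConvexOn ℝ K Ψ) {P₁ P₂ P₃ P₄ X : E} (h₁ : P₁ ∈ K)
    (h₃ : P₃ ∈ K) (h₄ : P₄ ∈ K) (z₁ : Ψ P₁ = 0) (z₃ : Ψ P₃ = 0) (z₄ : Ψ P₄ = 0) (h₁₃ : P₁ ≠ P₃)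
    {σ τ : ℝ} (hσ : 0 < σ) (hστ : σ ≤ τ) (hτ : τ ≤ 1 / 2)
    (hcross : (1 - σ) • P₁ + σ • P₃ = (1 - τ) • P₂ + τ • P₄)
    (hX : (2 : ℝ) • X = P₁ + P₂ + P₃ + P₄ - (2 : ℝ) • P₁) (hXpos : X ∈ K → 0 ≤ Ψ X) :
    P₁ + P₃ = P₂ + P₄ ∨ P₁ + P₄ = P₂ + P₃ := by
  have hτ1 : 0 < 1 - τ := by linarith
  have hσ1 : 0 < 1 - σ := by linarith
  set O := (1 - σ) • P₁ + σ • P₃ with hO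
  have hOK : O ∈ K := hΨ.1 h₁ h₃ hσ1.le hσ.le (by ring)
  have hO0 : Ψ O < 0 := by
    have := hΨ.2 h₁ h₃ h₁₃ hσ1 hσ (by ring)
    simpa [z₁, z₃] using this
  -- `P₁` and `P₂` in terms of the crossing point and the far ends of the diagonals
  have e₁ : P₁ = (1 - σ)⁻¹ • (O - σ • P₃) := by
    rw [eq_inv_smul_iff₀ hσ1.ne', hO]; abel
  have e₂ : P₂ = (1 - τ)⁻¹ • (O - τ • P₄) := by
    rw [eq_inv_smul_iff₀ hτ1.ne', hcross]; abel
  have hXeq : (1 / (2 * (1 - σ))) • P₃ + ((1 - 2 * τ) / (2 * (1 - τ))) • P₄ +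
      ((τ - σ) / (2 * (1 - σ) * (1 - τ))) • O = X := by
    have : X = (1 / 2 : ℝ) • (P₁ + P₂ + P₃ + P₄ - (2 : ℝ) • P₁) := by
      rw [← hX, smul_smul]; norm_num
    rw [this, e₁, e₂]
    match_scalars <;> field_simp <;> ring
  have hhull : X ∈ convexHull ℝ ({P₃, P₄, O} : Set E) := by
    rw [← hXeq]
    have hm : ∀ z ∈ ({P₃, P₄, O} : Set E), z ∈ convexHull ℝ ({P₃, P₄, O} : Set E) :=
      fun z hz => subset_convexHull ℝ _ hz
    have h := (convex_convexHull ℝ ({P₃, P₄, O} : Set E)).sum_mem (t := Finset.univ)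
      (w := ![1 / (2 * (1 - σ)), (1 - 2 * τ) / (2 * (1 - τ)),
        (τ - σ) / (2 * (1 - σ) * (1 - τ))]) (z := ![P₃, P₄, O]) ?_ ?_ ?_
    · simpa only [Fin.sum_univ_three, Matrix.cons_val] using h
    · intro i _
      fin_cases i
      · exact div_nonneg (by linarith) (by positivity)
      · exact div_nonneg (by linarith) (by positivity)
      · exact div_nonneg (by linarith) (by positivity)
    · simp only [Fin.sum_univ_three, Matrix.cons_val]
      field_simp
      ring
    · intro i _
      fin_cases i <;> exact hm _ (by simp)
  have hmem := hΨ.mem_of_mem_convexHull (Z := {P₃, P₄, O}) (by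
    rintro z (rfl | rfl | rfl)
    exacts [⟨h₃, z₃.le⟩, ⟨h₄, z₄.le⟩, ⟨hOK, hO0.le⟩]) hhull hXpos
  rcases hmem with h | h | h
  · left
    rw [h, two_smul, two_smul] at hX
    grind
  · right
    rw [h, two_smul, two_smul] at hX
    grind
  · rw [h] at hXpos
    exact absurd (hXpos hOK) (not_le.2 hO0)

/-- A quadrilateral with crossing diagonals and vertices at zeros of `Ψ` is a parallelogram if `Ψ` is
nonnegative at the reflections of its vertices in their centroid. After relabelling the vertices, the
crossing point is situated as in `parallelogram_of_crossing_aux`. -/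
theorem parallelogram_of_crossing {E : Type*} [AddCommGroup E] [Module ℝ E] {Ψ : E → ℝ}
    {K : Set E} (hΨ : StrictConvexOn ℝ K Ψ) {P₁ P₂ P₃ P₄ : E}
    (hK : ∀ Q ∈ ({P₁, P₂, P₃, P₄} : Set E), Q ∈ K ∧ Ψ Q = 0) (h₁₃ : P₁ ≠ P₃) (h₂₄ : P₂ ≠ P₄)
    (hX : ∀ Q ∈ ({P₁, P₂, P₃, P₄} : Set E),
      ∃ X, (2 : ℝ) • X = P₁ + P₂ + P₃ + P₄ - (2 : ℝ) • Q ∧ (X ∈ K → 0 ≤ Ψ X))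
    {σ τ : ℝ} (hσ : 0 < σ) (hσ1 : σ < 1) (hτ : 0 < τ) (hτ1 : τ < 1)
    (hcross : (1 - σ) • P₁ + σ • P₃ = (1 - τ) • P₂ + τ • P₄) :
    P₁ + P₃ = P₂ + P₄ ∨ P₁ + P₄ = P₂ + P₃ ∨ P₁ + P₂ = P₃ + P₄ := by
  wlog hσ2 : σ ≤ 1 / 2 generalizing P₁ P₃ σ
  · have e : P₃ + P₂ + P₁ + P₄ = P₁ + P₂ + P₃ + P₄ := by abel
    have := @this P₃ P₁ (fun Q hQ => hK Q (by simp at hQ ⊢; tauto)) h₁₃.symm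
      (fun Q hQ => by rw [e]; exact hX Q (by simp at hQ ⊢; tauto)) (1 - σ)
      (by linarith) (by linarith) (by rw [← hcross, sub_sub_cancel, add_comm])
      (by linarith)
    grind
  wlog hτ2 : τ ≤ 1 / 2 generalizing P₂ P₄ τ
  · have e : P₁ + P₄ + P₃ + P₂ = P₁ + P₂ + P₃ + P₄ := by abel
    have := @this P₄ P₂ h₂₄.symm (1 - τ) (by linarith) (by linarith)
      (fun Q hQ => hK Q (by simp at hQ ⊢; tauto))
      (fun Q hQ => by rw [e]; exact hX Q (by simp at hQ ⊢; tauto)) (by rw [hcross, sub_sub_cancel, add_comm])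
      (by linarith)
    grind
  wlog hστ : σ ≤ τ generalizing P₁ P₂ P₃ P₄ σ τ
  · have e : P₂ + P₁ + P₄ + P₃ = P₁ + P₂ + P₃ + P₄ := by abel
    have := @this P₂ P₄ h₂₄ τ hτ hτ1 hτ2 P₁ P₃ h₁₃ σ hσ hσ1
      (fun Q hQ => hK Q (by simp at hQ ⊢; tauto))
      (fun Q hQ => by rw [e]; exact hX Q (by simp at hQ ⊢; tauto)) hcross.symm hσ2 (by linarith)
    grind
  obtain ⟨X, hX2, hXpos⟩ := hX P₁ (by simp)
  have := parallelogram_of_crossing_aux hΨ (hK P₁ (by simp)).1 (hK P₃ (by simp)).1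
    (hK P₄ (by simp)).1 (hK P₁ (by simp)).2 (hK P₃ (by simp)).2 (hK P₄ (by simp)).2 h₁₃ hσ hστ hτ2
    hcross hX2 hXpos
  tauto

/-- Four points of the plane satisfy a nontrivial affine relation. For four distinct zeros of a
strictly convex function the relation has two coefficients of each sign. -/
theorem exists_crossing {Ψ : ℝ × ℝ → ℝ} {K : Set (ℝ × ℝ)} (hΨ : StrictConvexOn ℝ K Ψ)
    (P : Fin 4 → ℝ × ℝ) (hP : Function.Injective P) (hK : ∀ i, P i ∈ K ∧ Ψ (P i) = 0) :
    ∃ i j k l : Fin 4, ({i, j, k, l} : Finset (Fin 4)) = Finset.univ ∧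
      ∃ σ τ : ℝ, 0 < σ ∧ σ < 1 ∧ 0 < τ ∧ τ < 1 ∧
        (1 - σ) • P i + σ • P k = (1 - τ) • P j + τ • P l := by
  have hdep : ¬ AffineIndependent ℝ P := by
    intro h
    have := h.card_le_finrank_succ
    have h2 := Submodule.finrank_le (vectorSpan ℝ (Set.range P))
    simp at this h2
    omega
  obtain ⟨I, O, hO1, hO2⟩ := Convex.radon_partition hdep
  -- no vertex is in the hull of the others
  have hvert : ∀ (J : Set (Fin 4)) (i : Fin 4), i ∉ J → P i ∉ convexHull ℝ (P '' J) := by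
    intro J i hi h
    have := hΨ.mem_of_mem_convexHull (Z := P '' J) (by
      rintro _ ⟨j, -, rfl⟩
      exact ⟨(hK j).1, (hK j).2.le⟩) h (fun _ => (hK i).2.ge)
    rw [hP.mem_set_image] at this
    exact hi this
  have hcard : ∀ F : Finset (Fin 4), O ∈ convexHull ℝ (P '' F) →
      O ∈ convexHull ℝ (P '' (Fᶜ : Finset (Fin 4))) → 2 ≤ F.card := by
    intro F h1 h2
    by_contra! hlt
    interval_cases hF : F.card
    · rw [Finset.card_eq_zero] at hF
      simp [hF] at h1
    · obtain ⟨i, rfl⟩ := Finset.card_eq_one.1 hF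
      simp only [Finset.coe_singleton, Set.image_singleton, convexHull_singleton,
        Set.mem_singleton_iff] at h1
      rw [h1] at h2
      exact hvert _ i (by simp) h2
  have hseg : ∀ F : Finset (Fin 4), F.card = 2 → O ∈ convexHull ℝ (P '' F) →
      O ∈ convexHull ℝ (P '' (Fᶜ : Finset (Fin 4))) →
      ∃ i k, F = {i, k} ∧ ∃ σ : ℝ, 0 < σ ∧ σ < 1 ∧ (1 - σ) • P i + σ • P k = O := by
    intro F hF h1 h2
    obtain ⟨i, k, -, rfl⟩ := Finset.card_eq_two.1 hF
    refine ⟨i, k, rfl, ?_⟩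
    have h3 := h1
    rw [Finset.coe_pair, Set.image_pair, convexHull_pair, segment_eq_image] at h3
    obtain ⟨σ, ⟨hσ0, hσ1⟩, hσ⟩ := h3
    refine ⟨σ, lt_of_le_of_ne hσ0 ?_, lt_of_le_of_ne hσ1 ?_, hσ⟩
    · rintro rfl
      simp only [sub_zero, one_smul, zero_smul, add_zero] at hσ
      rw [← hσ] at h2
      exact hvert _ i (by simp) h2
    · rintro rfl
      simp only [sub_self, one_smul, zero_smul, zero_add] at hσ
      rw [← hσ] at h2
      exact hvert _ k (by simp) h2
  classical
  have hI : ((I.toFinset : Finset (Fin 4)) : Set (Fin 4)) = I := by simp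
  have hIc : ((I.toFinsetᶜ : Finset (Fin 4)) : Set (Fin 4)) = Iᶜ := by simp
  rw [← hI] at hO1
  rw [← hIc] at hO2
  have c1 := hcard _ hO1 hO2
  have c2 := hcard _ hO2 (by rwa [compl_compl])
  have c3 := Finset.card_add_card_compl I.toFinset
  rw [Fintype.card_fin] at c3
  obtain ⟨i, k, hik, σ, hσ⟩ := hseg _ (by omega) hO1 hO2
  obtain ⟨j, l, hjl, τ, hτ⟩ := hseg _ (by omega) hO2 (by rwa [compl_compl])
  refine ⟨i, j, k, l, ?_, σ, τ, hσ.1, hσ.2.1, hτ.1, hτ.2.1, hσ.2.2.trans hτ.2.2.symm⟩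
  have : ({i, j, k, l} : Finset (Fin 4)) = {i, k} ∪ {j, l} := by
    ext x; simp; tauto
  rw [this, ← hik, ← hjl, Finset.union_compl]

/-- The sum of four pairwise incongruent elements of `ℤ × ℤ` modulo `2` is even. -/
theorem sum_eq_zero_of_injective_zmod_two (f : Fin 4 → ZMod 2 × ZMod 2)
    (hf : Function.Injective f) : ∑ i, f i = 0 := by
  have hb : Function.Bijective f := by
    rw [Fintype.bijective_iff_injective_and_card]
    exact ⟨hf, by simp⟩
  rw [hb.sum_comp (fun x => x)]
  decide

/-- Four lattice points on the boundary of a strictly convex lattice-free region form a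
parallelogram. -/
theorem exists_parallelogram {Ψ : ℝ × ℝ → ℝ} {K : Set (ℝ × ℝ)} (hΨ : StrictConvexOn ℝ K Ψ)
    (hpos : ∀ z : ℤ × ℤ, latticePt z ∈ K → 0 ≤ Ψ (latticePt z))
    (P : Fin 4 → ℤ × ℤ) (hP : Function.Injective P)
    (hK : ∀ i, latticePt (P i) ∈ K ∧ Ψ (latticePt (P i)) = 0) :
    ∃ i j k l : Fin 4, ({i, j, k, l} : Finset (Fin 4)) = Finset.univ ∧ P i + P j = P k + P l := by
  obtain ⟨i, j, k, l, hu, σ, τ, hσ, hσ1, hτ, hτ1, hc⟩ :=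
    exists_crossing hΨ (fun i => latticePt (P i)) (latticePt_injective.comp hP) hK
  have hdist : i ≠ j ∧ i ≠ k ∧ i ≠ l ∧ j ≠ k ∧ j ≠ l ∧ k ≠ l := by
    clear hc
    revert hu; revert i j k l; decide
  obtain ⟨hij, hik, hil, hjk, hjl, hkl⟩ := hdist
  have hsum : ∀ {M : Type} [AddCommMonoid M] (f : Fin 4 → M),
      ∑ x, f x = f i + f j + f k + f l := by
    intro M _ f
    rw [← hu, Finset.sum_insert (by simp [hij, hik, hil]), Finset.sum_insert (by simp [hjk, hjl]),
      Finset.sum_insert (by simp [hkl]), Finset.sum_singleton]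
    abel
  -- half the sum of the vertices is a lattice point
  obtain ⟨H, hH⟩ : ∃ H : ℤ × ℤ, P i + P j + P k + P l = 2 • H := by
    have := sum_eq_zero_of_injective_zmod_two
      (fun x => (((P x).1 : ZMod 2), ((P x).2 : ZMod 2))) (by
        intro x y hxy
        by_contra hne
        exact not_congr_mod_two hΨ hpos (hK x).1 (hK y).1 (hK x).2 (hK y).2 (hP.ne hne) hxy)
    rw [hsum] at this
    simp only [Prod.mk_add_mk, Prod.mk_eq_zero] at this
    obtain ⟨h1, h2⟩ := this
    norm_cast at h1 h2
    rw [ZMod.intCast_zmod_eq_zero_iff_dvd] at h1 h2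
    obtain ⟨a, ha⟩ := h1
    obtain ⟨b, hb⟩ := h2
    exact ⟨(a, b), by ext <;> simp <;> push_cast at ha hb <;> linarith⟩
  have hHr : latticePt (P i) + latticePt (P j) + latticePt (P k) + latticePt (P l) =
      (2 : ℝ) • latticePt H := by
    have h1 := congrArg Prod.fst hH
    have h2 := congrArg Prod.snd hH
    simp at h1 h2
    ext <;> simp [latticePt] <;> norm_cast
  have := parallelogram_of_crossing hΨ (P₁ := latticePt (P i)) (P₂ := latticePt (P j))
    (P₃ := latticePt (P k)) (P₄ := latticePt (P l))
    (by rintro Q (rfl | rfl | rfl | rfl) <;> exact hK _)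
    (latticePt_injective.ne (hP.ne hik)) (latticePt_injective.ne (hP.ne hjl)) (by
      have hall : ∀ x : Fin 4, ∃ X : ℝ × ℝ, (2 : ℝ) • X = latticePt (P i) + latticePt (P j) +
          latticePt (P k) + latticePt (P l) - (2 : ℝ) • latticePt (P x) ∧ (X ∈ K → 0 ≤ Ψ X) := by
        intro x
        refine ⟨latticePt (H - P x), ?_, hpos _⟩
        rw [hHr]
        ext <;> simp [latticePt] <;> ring
      rintro Q (rfl | rfl | rfl | rfl) <;> exact hall _) hσ hσ1 hτ hτ1 hc
  have hadd : ∀ a b : ℤ × ℤ, latticePt a + latticePt b = latticePt (a + b) := by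
    intro a b; ext <;> simp [latticePt]
  simp only [hadd, latticePt_injective.eq_iff] at this
  rcases this with h | h | h
  · exact ⟨i, k, j, l, by rw [← hu]; ext; simp; tauto, h⟩
  · exact ⟨i, l, j, k, by rw [← hu]; ext; simp; tauto, h⟩
  · exact ⟨i, j, k, l, hu, h⟩

/-! ### Minima of the distance profile of a loxodromic orbit -/

/-- The function `k ↦ -(p · Aᵏ x)`, i.e. `cosh (d(p, Aᵏ x))`, for a loxodromic `A` with translation
length `L` and rotation angle `θ`. -/
noncomputable def profile (L b C γ θ φ : ℝ) (k : ℤ) : ℝ :=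
  C * Real.cosh (L * k - b) - γ * Real.cos (k * θ + φ)

section profile

variable {L b C γ θ φ : ℝ}

theorem profile_add_profile_sub (k : ℤ) :
    profile L b C γ θ φ (k + 1) - profile L b C γ θ φ k =
      profile L b C γ θ φ k - profile L b C γ θ φ (k - 1) +
        2 * (C * Real.cosh (L * k - b) * (Real.cosh L - 1) +
          γ * Real.cos (k * θ + φ) * (1 - Real.cos θ)) := by
  have e1 : L * ((k + 1 : ℤ) : ℝ) - b = (L * k - b) + L := by push_cast; ring
  have e2 : L * ((k - 1 : ℤ) : ℝ) - b = (L * k - b) - L := by push_cast; ring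
  have e3 : ((k + 1 : ℤ) : ℝ) * θ + φ = (k * θ + φ) + θ := by push_cast; ring
  have e4 : ((k - 1 : ℤ) : ℝ) * θ + φ = (k * θ + φ) - θ := by push_cast; ring
  simp only [profile]
  rw [e1, e2, e3, e4, Real.cosh_add (L * k - b), Real.cosh_sub (L * k - b) L,
    Real.cos_add (k * θ + φ), Real.cos_sub (k * θ + φ)]
  ring

/-- If the rotation is small compared to the translation, then the profile is convex on `ℤ`, and
strictly so except at one integer at most. -/
theorem profile_minima_close (hL : 0 < L) (hC : 0 < C) (hγ : 0 ≤ γ)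
    (hconv : γ * (1 - Real.cos θ) ≤ C * (Real.cosh L - 1)) {k k' : ℤ}
    (hk : ∀ j, profile L b C γ θ φ k ≤ profile L b C γ θ φ j)
    (hk' : ∀ j, profile L b C γ θ φ k' ≤ profile L b C γ θ φ j) : k' ≤ k + 2 := by
  by_contra! hlt
  set f := profile L b C γ θ φ
  have hcL : 0 < Real.cosh L - 1 := sub_pos.2 (Real.one_lt_cosh.2 hL.ne')
  have hbound : ∀ j : ℤ, f j - f (j - 1) + 2 * (C * (Real.cosh L - 1) *
      (Real.cosh (L * j - b) - 1)) ≤ f (j + 1) - f j := by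
    intro j
    rw [profile_add_profile_sub j]
    have h1 : 0 ≤ γ * (1 - Real.cos θ) := mul_nonneg hγ (sub_nonneg.2 (Real.cos_le_one θ))
    have h2 := Real.neg_one_le_cos (j * θ + φ)
    have h3 : -(γ * (1 - Real.cos θ)) ≤ γ * (1 - Real.cos θ) * Real.cos (j * θ + φ) := by
      nlinarith
    have h4 : γ * Real.cos (j * θ + φ) * (1 - Real.cos θ) =
      γ * (1 - Real.cos θ) * Real.cos (j * θ + φ) := by ring
    have h5 : C * Real.cosh (L * j - b) * (Real.cosh L - 1) =
      C * (Real.cosh L - 1) * (Real.cosh (L * j - b) - 1) + C * (Real.cosh L - 1) := by ring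
    rw [h4, h5]
    linarith
  have hmono : ∀ j : ℤ, f j - f (j - 1) ≤ f (j + 1) - f j := by
    intro j
    have := hbound j
    have h1 := Real.one_le_cosh (L * j - b)
    have : 0 ≤ C * (Real.cosh L - 1) * (Real.cosh (L * j - b) - 1) :=
      mul_nonneg (by positivity) (by linarith)
    linarith [hbound j]
  have hstrict : ∀ j : ℤ, L * j - b ≠ 0 → f j - f (j - 1) < f (j + 1) - f j := by
    intro j hj
    have h1 := Real.one_lt_cosh.2 hj
    have : 0 < C * (Real.cosh L - 1) * (Real.cosh (L * j - b) - 1) :=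
      mul_pos (by positivity) (by linarith)
    linarith [hbound j]
  have hd0 : 0 ≤ f (k + 1) - f k := sub_nonneg.2 (hk _)
  have m1 := hmono (k + 1)
  have m2 := hmono (k + 1 + 1)
  rw [add_sub_cancel_right] at m1 m2
  have hd2 : 0 < f (k + 1 + 1 + 1) - f (k + 1 + 1) := by
    by_cases h : L * ((k + 1 : ℤ) : ℝ) - b = 0
    · have h' : L * ((k + 1 + 1 : ℤ) : ℝ) - b ≠ 0 := by
        intro h2
        push_cast at h h2
        linarith
      have := hstrict _ h'
      rw [add_sub_cancel_right] at this
      linarith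
    · have := hstrict _ h
      rw [add_sub_cancel_right] at this
      linarith
  have hinc : ∀ n : ℕ, 0 < f (k + 1 + 1 + n + 1) - f (k + 1 + 1 + n) := by
    intro n
    induction n with
    | zero => simpa using hd2
    | succ n ih =>
      have := hmono (k + 1 + 1 + n + 1)
      rw [add_sub_cancel_right] at this
      have e : k + 1 + 1 + ((n + 1 : ℕ) : ℤ) = k + 1 + 1 + n + 1 := by push_cast; ring
      rw [e]
      linarith
  have hgt : ∀ n : ℕ, f k < f (k + 1 + 1 + n + 1) := by
    intro n
    induction n with
    | zero => linarith [hinc 0, hk (k + 1 + 1 + (0 : ℕ))]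
    | succ n ih =>
      have := hinc (n + 1)
      have e : k + 1 + 1 + ((n + 1 : ℕ) : ℤ) = k + 1 + 1 + n + 1 := by push_cast; ring
      rw [e] at this ⊢
      linarith
  obtain ⟨n, hn⟩ := Int.eq_ofNat_of_zero_le (show 0 ≤ k' - (k + 3) by omega)
  have := hgt n
  rw [show k + 1 + 1 + (n : ℤ) + 1 = k' by omega] at this
  exact absurd (hk' k) (not_le.2 this)

/-- If the rotation is large compared to the translation, then a ball without orbit points in its
interior contains no full circle of the cylinder around the axis on which the orbit lies. -/
theorem exists_profile_lt (hL : 0 < L) (hγC : γ < C) (hγ : 0 ≤ γ)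
    (hconv : C * (Real.cosh L - 1) < γ * (1 - Real.cos θ)) :
    ∃ k, profile L b C γ θ φ k < C + γ := by
  have hC : 0 < C := hγ.trans_lt hγC
  by_contra! h
  -- the assumption in terms of half arguments; it is used for the orbit points right below and
  -- above the point `p`, which has height `b`
  have hsq : ∀ k : ℤ, √γ * |Real.cos ((k * θ + φ) / 2)| ≤ √C * Real.sinh |(L * k - b) / 2| := by
    intro k
    have hk := h k
    have e1 : Real.cosh (L * k - b) = 1 + 2 * Real.sinh ((L * k - b) / 2) ^ 2 := by
      have := Real.cosh_two_mul ((L * k - b) / 2)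
      rw [Real.cosh_sq, mul_div_cancel₀ _ two_ne_zero] at this
      linarith
    have e2 : Real.cos (k * θ + φ) = 2 * Real.cos ((k * θ + φ) / 2) ^ 2 - 1 := by
      rw [← Real.cos_two_mul, mul_div_cancel₀ _ two_ne_zero]
    rw [profile, e1, e2] at hk
    rw [← Real.abs_sinh]
    refine le_of_sq_le_sq ?_ (by positivity)
    rw [mul_pow, mul_pow, Real.sq_sqrt hγ, Real.sq_sqrt hC.le, sq_abs, sq_abs]
    linarith
  have hk1 : (⌊b / L⌋ : ℝ) * L ≤ b := (le_div_iff₀ hL).1 (Int.floor_le _)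
  have hk2 : b < (⌊b / L⌋ + 1 : ℝ) * L := (div_lt_iff₀ hL).1 (Int.lt_floor_add_one _)
  set k := ⌊b / L⌋
  have h1 := hsq k
  have h2 := hsq (k + 1)
  push_cast at h2
  rw [abs_of_nonpos (show (L * k - b) / 2 ≤ 0 by linarith)] at h1
  rw [abs_of_nonneg (show 0 ≤ (L * (k + 1) - b) / 2 by linarith)] at h2
  have hx : 0 ≤ Real.sinh (-((L * k - b) / 2)) := Real.sinh_nonneg_iff.2 (by linarith)
  have hy : 0 ≤ Real.sinh ((L * (k + 1) - b) / 2) := Real.sinh_nonneg_iff.2 (by linarith)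
  have hadd : Real.sinh (-((L * k - b) / 2)) + Real.sinh ((L * (k + 1) - b) / 2) ≤
      Real.sinh (L / 2) := by
    have e : L / 2 = -((L * k - b) / 2) + (L * (k + 1) - b) / 2 := by ring
    rw [e, Real.sinh_add]
    nlinarith [Real.one_le_cosh (-((L * k - b) / 2)), Real.one_le_cosh ((L * (k + 1) - b) / 2)]
  have hsin : |Real.sin (θ / 2)| ≤
      |Real.cos ((k * θ + φ) / 2)| + |Real.cos (((k + 1) * θ + φ) / 2)| := by
    have e : θ / 2 = ((k + 1) * θ + φ) / 2 - (k * θ + φ) / 2 := by ring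
    rw [e, Real.sin_sub]
    refine (abs_sub _ _).trans ?_
    rw [abs_mul, abs_mul]
    nlinarith [Real.abs_sin_le_one (((k + 1) * θ + φ) / 2), Real.abs_sin_le_one ((k * θ + φ) / 2),
      abs_nonneg (Real.cos ((k * θ + φ) / 2)), abs_nonneg (Real.cos (((k + 1) * θ + φ) / 2))]
  have hfin : √γ * |Real.sin (θ / 2)| ≤ √C * Real.sinh (L / 2) := by
    have := mul_le_mul_of_nonneg_left hsin (Real.sqrt_nonneg γ)
    have := mul_le_mul_of_nonneg_left hadd (Real.sqrt_nonneg C)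
    linarith
  have hfin2 := pow_le_pow_left₀ (by positivity) hfin 2
  rw [mul_pow, mul_pow, Real.sq_sqrt hγ, Real.sq_sqrt hC.le, sq_abs] at hfin2
  have e1 : Real.cosh L = 1 + 2 * Real.sinh (L / 2) ^ 2 := by
    have := Real.cosh_two_mul (L / 2)
    rw [Real.cosh_sq, mul_div_cancel₀ _ two_ne_zero] at this
    linarith
  have e2 : Real.cos θ = 1 - 2 * Real.sin (θ / 2) ^ 2 := by
    have := Real.cos_two_mul (θ / 2)
    rw [Real.cos_sq', mul_div_cancel₀ _ two_ne_zero] at this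
    linarith
  rw [e1, e2] at hconv
  linarith

/-- If the rotation is large compared to the translation, then the integers at which the profile
is minimal lift to lattice points on the boundary of a strictly convex lattice-free region. The
first coordinate of the plane is the real extension of the index, the second one counts full turns
around the axis. -/
theorem exists_strictConvexOn_of_minimum (hL : 0 < L) (hγC : γ < C) (hγ : 0 ≤ γ)
    (hconv : C * (Real.cosh L - 1) < γ * (1 - Real.cos θ)) {k₀ : ℤ}
    (hk₀ : ∀ j, profile L b C γ θ φ k₀ ≤ profile L b C γ θ φ j) :
    ∃ (Ψ : ℝ × ℝ → ℝ) (K : Set (ℝ × ℝ)), StrictConvexOn ℝ K Ψ ∧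
      (∀ z : ℤ × ℤ, latticePt z ∈ K → 0 ≤ Ψ (latticePt z)) ∧
      ∀ k : ℤ, (∀ j, profile L b C γ θ φ k ≤ profile L b C γ θ φ j) →
        ∃ j : ℤ, latticePt (k, j) ∈ K ∧ Ψ (latticePt (k, j)) = 0 := by
  have hC : 0 < C := hγ.trans_lt hγC
  have hγ0 : 0 < γ := by
    rcases hγ.eq_or_lt with rfl | h
    · have := Real.one_lt_cosh.2 hL.ne'
      nlinarith
    · exact h
  obtain ⟨k₁, hk₁⟩ := exists_profile_lt (b := b) (φ := φ) hL hγC hγ hconv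
  set m := profile L b C γ θ φ k₀ with hm
  have hmlt : m < C + γ := (hk₀ k₁).trans_lt hk₁
  set D := (C + γ - m) / (2 * C) with hDdef
  have hD : 0 < D := div_pos (by linarith) (by linarith)
  have hs : 0 < √(γ / C) := Real.sqrt_pos.2 (by positivity)
  have hΦ := strictConvexOn_strip hD hs
  set Φ : ℝ × ℝ → ℝ := fun z => √(Real.sinh (z.1 / 2) ^ 2 + D) - √(γ / C) * Real.cos (z.2 / 2)
    with hΦdef
  set S : Set (ℝ × ℝ) := Set.univ ×ˢ Set.Icc (-Real.pi) Real.pi with hS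
  let T : ℝ × ℝ → ℝ × ℝ := fun z => (L * z.1 - b, z.1 * θ + φ - 2 * Real.pi * z.2)
  have hTinj : Function.Injective T := by
    rintro ⟨x, y⟩ ⟨x', y'⟩ h
    simp only [T, Prod.mk.injEq] at h
    obtain ⟨h1, h2⟩ := h
    have hx : x = x' := mul_left_cancel₀ hL.ne' (by linarith)
    subst hx
    have hy : y = y' := mul_left_cancel₀ Real.two_pi_pos.ne' (by linarith)
    rw [hy]
  have hTaff : ∀ (x y : ℝ × ℝ) (a c : ℝ), a + c = 1 → T (a • x + c • y) = a • T x + c • T y := by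
    rintro ⟨x, y⟩ ⟨x', y'⟩ a c hac
    obtain rfl : c = 1 - a := by linarith
    ext <;> simp [T] <;> ring
  have hsign : ∀ k j : ℤ, T (latticePt (k, j)) ∈ S →
      (m ≤ profile L b C γ θ φ k ↔ 0 ≤ Φ (T (latticePt (k, j)))) ∧
      (profile L b C γ θ φ k ≤ m ↔ Φ (T (latticePt (k, j))) ≤ 0) := by
    intro k j hkj
    simp only [T, latticePt, hS, Set.mem_prod, Set.mem_univ, true_and, Set.mem_Icc] at hkj
    have e1 : Real.cosh (L * k - b) = 1 + 2 * Real.sinh ((L * k - b) / 2) ^ 2 := by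
      have := Real.cosh_two_mul ((L * k - b) / 2)
      rw [Real.cosh_sq, mul_div_cancel₀ _ two_ne_zero] at this
      linarith
    have e2 : Real.cos (k * θ + φ) =
        2 * Real.cos ((k * θ + φ - 2 * Real.pi * j) / 2) ^ 2 - 1 := by
      rw [← Real.cos_two_mul, mul_div_cancel₀ _ two_ne_zero, mul_comm (2 * Real.pi),
        Real.cos_sub_int_mul_two_pi]
    have hcos : 0 ≤ Real.cos ((k * θ + φ - 2 * Real.pi * j) / 2) :=
      Real.cos_nonneg_of_mem_Icc ⟨by linarith [hkj.1], by linarith [hkj.2]⟩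
    have e3 : √(γ / C) * Real.cos ((k * θ + φ - 2 * Real.pi * j) / 2) =
        √(γ / C * Real.cos ((k * θ + φ - 2 * Real.pi * j) / 2) ^ 2) := by
      rw [Real.sqrt_mul (by positivity), Real.sqrt_sq hcos]
    have e4 : profile L b C γ θ φ k - m =
        2 * C * (Real.sinh ((L * k - b) / 2) ^ 2 + D -
          γ / C * Real.cos ((k * θ + φ - 2 * Real.pi * j) / 2) ^ 2) := by
      rw [profile, e1, e2, hDdef]
      field_simp
      ring
    simp only [hΦdef, T, latticePt]
    rw [e3, sub_nonneg, sub_nonpos, Real.sqrt_le_sqrt_iff (by positivity),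
      Real.sqrt_le_sqrt_iff (by positivity), ← sub_nonneg (b := m), ← sub_nonpos (b := m), e4]
    constructor
    · rw [mul_nonneg_iff_of_pos_left (by positivity), sub_nonneg]
    · rw [← neg_nonneg, ← mul_neg, mul_nonneg_iff_of_pos_left (by positivity), neg_sub, sub_nonneg]
  refine ⟨Φ ∘ T, T ⁻¹' S, ⟨?_, ?_⟩, ?_, ?_⟩
  · intro x hx y hy a c ha hc hac
    rw [Set.mem_preimage, hTaff x y a c hac]
    exact hΦ.1 hx hy ha hc hac
  · intro x hx y hy hxy a c ha hc hac
    simp only [Function.comp_apply]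
    rw [hTaff x y a c hac]
    exact hΦ.2 hx hy (hTinj.ne hxy) ha hc hac
  · rintro ⟨k, j⟩ hz
    exact (hsign k j hz).1.1 (hk₀ k)
  · intro k hk
    refine ⟨round ((k * θ + φ) / (2 * Real.pi)), ?_⟩
    have hmem : T (latticePt (k, round ((k * θ + φ) / (2 * Real.pi)))) ∈ S := by
      have h := abs_sub_round ((k * θ + φ) / (2 * Real.pi))
      simp only [T, latticePt, hS, Set.mem_prod, Set.mem_univ, true_and, Set.mem_Icc]
      rw [← abs_le]
      have e : (k : ℝ) * θ + φ - 2 * Real.pi * round ((k * θ + φ) / (2 * Real.pi)) =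
          2 * Real.pi * ((k * θ + φ) / (2 * Real.pi) - round ((k * θ + φ) / (2 * Real.pi))) := by
        field_simp
      rw [e, abs_mul, abs_of_pos Real.two_pi_pos]
      nlinarith [Real.pi_pos]
    exact ⟨hmem, le_antisymm ((hsign k _ hmem).2.1 (hk k₀)) ((hsign k _ hmem).1.1 (hk₀ k))⟩

/-- The profile is minimal at four integers at most. -/
theorem not_injective_five_minima (hL : 0 < L) (hγC : γ < C) (hγ : 0 ≤ γ) (e : Fin 5 → ℤ)
    (he : ∀ i j, profile L b C γ θ φ (e i) ≤ profile L b C γ θ φ j) :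
    ¬ Function.Injective e := by
  intro hinj
  rcases le_or_gt (γ * (1 - Real.cos θ)) (C * (Real.cosh L - 1)) with hconv | hconv
  · have h := fun i j => profile_minima_close hL (hγ.trans_lt hγC) hγ hconv (he i) (he j)
    obtain ⟨i, -, hi⟩ := Finset.exists_min_image Finset.univ e Finset.univ_nonempty
    have : Finset.univ.image e ⊆ Finset.Icc (e i) (e i + 2) := by
      intro x hx
      obtain ⟨j, -, rfl⟩ := Finset.mem_image.1 hx
      exact Finset.mem_Icc.2 ⟨hi j (Finset.mem_univ _), h i j⟩
    have := Finset.card_le_card this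
    rw [Finset.card_image_of_injective _ hinj, Finset.card_univ, Fintype.card_fin,
      Int.card_Icc] at this
    omega
  · obtain ⟨Ψ, K, hΨ, hpos, hzero⟩ := exists_strictConvexOn_of_minimum hL hγC hγ hconv (he 0)
    choose j hj using fun i => hzero (e i) (he i)
    obtain ⟨x, y, hxy, h⟩ := Fintype.exists_ne_map_eq_of_card_lt
      (fun i => ((e i : ZMod 2), (j i : ZMod 2))) (by simp)
    exact not_congr_mod_two hΨ hpos (hj x).1 (hj y).1 (hj x).2 (hj y).2
      (fun h => hxy (hinj (congrArg Prod.fst h))) h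

/-- If the profile is minimal at four integers, then these form two pairs with the same sum. -/
theorem minima_pair_sums (hL : 0 < L) (hγC : γ < C) (hγ : 0 ≤ γ) (e : Fin 4 → ℤ)
    (hinj : Function.Injective e)
    (he : ∀ i j, profile L b C γ θ φ (e i) ≤ profile L b C γ θ φ j) :
    ∃ i j k l : Fin 4, ({i, j, k, l} : Finset (Fin 4)) = Finset.univ ∧ e i + e j = e k + e l := by
  rcases le_or_gt (γ * (1 - Real.cos θ)) (C * (Real.cosh L - 1)) with hconv | hconv
  · have h := fun i j => profile_minima_close hL (hγ.trans_lt hγC) hγ hconv (he i) (he j)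
    obtain ⟨i, -, hi⟩ := Finset.exists_min_image Finset.univ e Finset.univ_nonempty
    have : Finset.univ.image e ⊆ Finset.Icc (e i) (e i + 2) := by
      intro x hx
      obtain ⟨j, -, rfl⟩ := Finset.mem_image.1 hx
      exact Finset.mem_Icc.2 ⟨hi j (Finset.mem_univ _), h i j⟩
    have := Finset.card_le_card this
    rw [Finset.card_image_of_injective _ hinj, Finset.card_univ, Fintype.card_fin,
      Int.card_Icc] at this
    omega
  · obtain ⟨Ψ, K, hΨ, hpos, hzero⟩ := exists_strictConvexOn_of_minimum hL hγC hγ hconv (he 0)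
    choose j hj using fun i => hzero (e i) (he i)
    obtain ⟨i₁, i₂, i₃, i₄, hu, h⟩ := exists_parallelogram hΨ hpos (fun i => (e i, j i))
      (fun x y hxy => hinj (congrArg Prod.fst hxy)) hj
    exact ⟨i₁, i₂, i₃, i₄, hu, congrArg Prod.fst h⟩

/-- Four integers `k, k + a, l, l + a` at which the profile is minimal cannot satisfy the relation that holds for linearly dependent orbit points: translating the
relation by `a` shows that the translated integers are minima as well, and so on. -/
theorem false_of_parallelogram_relation (hL : 0 < L) (hγC : γ < C) (hγ : 0 ≤ γ) {k l a : ℤ}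
    (ha : 0 < a) {c d : ℝ} (hc : 0 < c) (hd : 0 < d)
    (hmin : ∀ i ∈ ({k, k + a, l, l + a} : Finset ℤ), ∀ j,
      profile L b C γ θ φ i ≤ profile L b C γ θ φ j)
    (hrel : ∀ j : ℤ, c * (profile L b C γ θ φ (k + j) - profile L b C γ θ φ (l + a + j)) =
      d * (profile L b C γ θ φ (k + a + j) - profile L b C γ θ φ (l + j))) : False := by
  set f := profile L b C γ θ φ
  have hind : ∀ n : ℕ, (∀ j, f (k + n * a) ≤ f j) ∧ (∀ j, f (k + a + n * a) ≤ f j) ∧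
      (∀ j, f (l + n * a) ≤ f j) ∧ ∀ j, f (l + a + n * a) ≤ f j := by
    intro n
    induction n with
    | zero => simpa using ⟨hmin k (by simp), hmin (k + a) (by simp), hmin l (by simp),
        hmin (l + a) (by simp)⟩
    | succ n ih =>
      obtain ⟨h1, h2, h3, h4⟩ := ih
      have hr := hrel (((n + 1 : ℕ) : ℤ) * a)
      have ek : k + ((n + 1 : ℕ) : ℤ) * a = k + a + n * a := by push_cast; ring
      have el : l + ((n + 1 : ℕ) : ℤ) * a = l + a + n * a := by push_cast; ring
      have e : f (k + a + n * a) = f (l + a + n * a) := le_antisymm (h2 _) (h4 _)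
      rw [ek, el] at hr ⊢
      have p1 := h2 (l + a + ((n + 1 : ℕ) : ℤ) * a)
      have p2 := h4 (k + a + ((n + 1 : ℕ) : ℤ) * a)
      have q1 : f (l + a + ((n + 1 : ℕ) : ℤ) * a) = f (k + a + n * a) := by nlinarith
      have q2 : f (k + a + ((n + 1 : ℕ) : ℤ) * a) = f (l + a + n * a) := by nlinarith
      exact ⟨h2, fun j => q2 ▸ h4 j, h4, fun j => q1 ▸ h2 j⟩
  refine not_injective_five_minima hL hγC hγ (fun i : Fin 5 => k + (i : ℕ) * a)
    (fun i => (hind i).1) ?_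
  intro x y hxy
  have : ((x : ℕ) : ℤ) * a = ((y : ℕ) : ℤ) * a := by simpa using hxy
  have := mul_right_cancel₀ ha.ne' this
  exact Fin.ext (by exact_mod_cast this)

/-- Orbit points whose distance to `p` is minimal satisfy no nontrivial linear relation `d`. The
hypotheses list what such a relation implies for the coordinates with respect to the two fixed points
at infinity, and, after translation by all powers of the loxodromic, for the distances to `p`. -/
theorem eq_zero_of_relation (hL : 0 < L) (hγC : γ < C) (hγ : 0 ≤ γ) (s : Finset ℤ)
    (hs : ∀ k ∈ s, ∀ j, profile L b C γ θ φ k ≤ profile L b C γ θ φ j) (d : ℤ → ℝ)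
    (h0 : ∑ k ∈ s, d k = 0) (h1 : ∑ k ∈ s, d k * Real.exp (L * k) = 0)
    (h2 : ∑ k ∈ s, d k * Real.exp (-(L * k)) = 0)
    (hf : ∀ j : ℤ, ∑ k ∈ s, d k * profile L b C γ θ φ (k + j) = 0) : ∀ k ∈ s, d k = 0 := by
  set t := s.filter fun k => d k ≠ 0 with ht
  have hst : ∀ w : ℤ → ℝ, ∑ k ∈ t, d k * w k = ∑ k ∈ s, d k * w k := by
    intro w
    refine Finset.sum_filter_of_ne fun k _ h hk => h ?_
    rw [hk, zero_mul]
  have hmin : ∀ k ∈ t, ∀ j, profile L b C γ θ φ k ≤ profile L b C γ θ φ j :=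
    fun k hk => hs k (Finset.mem_filter.1 hk).1
  have hne : ∀ k ∈ t, d k ≠ 0 := fun k hk => (Finset.mem_filter.1 hk).2
  suffices hte : t = ∅ by
    intro k hk
    by_contra h
    have : k ∈ t := Finset.mem_filter.2 ⟨hk, h⟩
    rw [hte] at this
    simp at this
  set X : ℤ → ℝ := fun k => Real.exp (L * k) with hX
  have hXpos : ∀ k, 0 < X k := fun k => Real.exp_pos _
  have hXmono : StrictMono X := fun i j hij =>
    Real.exp_lt_exp.2 (mul_lt_mul_of_pos_left (by exact_mod_cast hij) hL)
  have hXinv : ∀ k : ℤ, Real.exp (-(L * k)) = (X k)⁻¹ := fun k => Real.exp_neg _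
  -- the relation applied to the functions `(X - X r₁) (X - X r₂) / X`
  have hquad : ∀ r₁ r₂ : ℤ, ∑ k ∈ t, d k * ((X k - X r₁) * (X k - X r₂) / X k) = 0 := by
    intro r₁ r₂
    rw [hst]
    have : ∀ k ∈ s, d k * ((X k - X r₁) * (X k - X r₂) / X k) =
        d k * Real.exp (L * k) - (X r₁ + X r₂) * d k +
          X r₁ * X r₂ * (d k * Real.exp (-(L * k))) := by
      intro k _
      rw [hXinv]
      change _ = d k * X k - _ + _
      have := (hXpos k).ne'
      field_simp
      ring
    rw [Finset.sum_congr rfl this, Finset.sum_add_distrib, Finset.sum_sub_distrib,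
      ← Finset.mul_sum, ← Finset.mul_sum, h0, h1, h2]
    simp
  by_contra hte
  obtain ⟨k₀, hk₀⟩ := Finset.nonempty_iff_ne_empty.2 hte
  rcases lt_or_ge 4 t.card with h5 | h4
  · obtain ⟨u, hut, hu5⟩ := Finset.exists_subset_card_eq (show 5 ≤ t.card by omega)
    exact not_injective_five_minima hL hγC hγ (u.orderEmbOfFin hu5)
      (fun i => hmin _ (hut (Finset.orderEmbOfFin_mem u hu5 i))) (u.orderEmbOfFin hu5).injective
  rcases h4.lt_or_eq with h3 | h4
  · obtain ⟨r₁, r₂, hr₁, hr₂, hsub⟩ : ∃ r₁ r₂ : ℤ, r₁ ≠ k₀ ∧ r₂ ≠ k₀ ∧ t.erase k₀ ⊆ {r₁, r₂} := by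
      have hcard : (t.erase k₀).card ≤ 2 := by rw [Finset.card_erase_of_mem hk₀]; omega
      have hmem : ∀ r ∈ t.erase k₀, r ≠ k₀ := fun r hr => Finset.ne_of_mem_erase hr
      interval_cases h : (t.erase k₀).card
      · rw [Finset.card_eq_zero] at h
        exact ⟨k₀ + 1, k₀ + 1, by omega, by omega, by simp [h]⟩
      · obtain ⟨r, hr⟩ := Finset.card_eq_one.1 h
        exact ⟨r, r, hmem r (by simp [hr]), hmem r (by simp [hr]), by simp [hr]⟩
      · obtain ⟨r, r', -, hr⟩ := Finset.card_eq_two.1 h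
        exact ⟨r, r', hmem r (by simp [hr]), hmem r' (by simp [hr]), by simp [hr]⟩
    have := hquad r₁ r₂
    rw [← Finset.add_sum_erase t _ hk₀, Finset.sum_eq_zero, add_zero] at this
    · refine mul_ne_zero (hne k₀ hk₀) (div_ne_zero (mul_ne_zero ?_ ?_) (hXpos _).ne') this
      · exact sub_ne_zero.2 (hXmono.injective.ne hr₁.symm)
      · exact sub_ne_zero.2 (hXmono.injective.ne hr₂.symm)
    · intro k hk
      have := hsub hk
      simp only [Finset.mem_insert, Finset.mem_singleton] at this
      rcases this with rfl | rfl <;> simp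
  · set e := t.orderEmbOfFin h4 with he
    have het : ∀ i, e i ∈ t := Finset.orderEmbOfFin_mem t h4
    have hsum : ∀ w : ℤ → ℝ, ∑ k ∈ t, w k = w (e 0) + w (e 1) + w (e 2) + w (e 3) := by
      intro w
      rw [← Fin.sum_univ_four (fun i => w (e i))]
      conv_lhs => rw [← Finset.map_orderEmbOfFin_univ t h4, Finset.sum_map]
      rfl
    have o1 : e 0 < e 1 := e.strictMono (by decide)
    have o2 : e 1 < e 2 := e.strictMono (by decide)
    have o3 : e 2 < e 3 := e.strictMono (by decide)
    have hpar : e 0 + e 3 = e 1 + e 2 := by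
      obtain ⟨i, j, k, l, hu, h⟩ := minima_pair_sums hL hγC hγ e e.injective
        (fun i => hmin _ (het i))
      revert hu h
      fin_cases i <;> fin_cases j <;> fin_cases k <;> fin_cases l <;>
        first
        | exact fun hu => absurd hu (by decide)
        | exact fun _ h => by simp at h; omega
    have hXpar : X (e 0) * X (e 3) = X (e 1) * X (e 2) := by
      simp only [hX, ← Real.exp_add, ← mul_add]
      congr 2
      exact_mod_cast hpar
    have hd03 : d (e 3) = -d (e 0) := by
      have h := hquad (e 1) (e 2)
      rw [hsum] at h
      simp only [sub_self, zero_mul, mul_zero, zero_div, add_zero] at h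
      have q : (X (e 3) - X (e 1)) * (X (e 3) - X (e 2)) / X (e 3) =
          (X (e 0) - X (e 1)) * (X (e 0) - X (e 2)) / X (e 0) := by
        rw [div_eq_div_iff (hXpos _).ne' (hXpos _).ne']
        linear_combination (X (e 3) - X (e 0)) * hXpar
      rw [q, ← add_mul] at h
      have hq : (X (e 0) - X (e 1)) * (X (e 0) - X (e 2)) / X (e 0) ≠ 0 :=
        div_ne_zero (mul_ne_zero (sub_ne_zero.2 (hXmono o1).ne)
          (sub_ne_zero.2 (hXmono (o1.trans o2)).ne)) (hXpos _).ne'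
      have := (mul_eq_zero.1 h).resolve_right hq
      linarith
    have hd12 : d (e 2) = -d (e 1) := by
      have h := hst fun _ => 1
      simp only [mul_one, h0] at h
      rw [hsum] at h
      linarith
    have hlin : d (e 0) * (X (e 3) - X (e 0)) = -d (e 1) * (X (e 2) - X (e 1)) := by
      have h := hst X
      rw [hsum, h1, hd03, hd12] at h
      linarith
    have p03 : 0 < X (e 3) - X (e 0) := sub_pos.2 (hXmono (o1.trans (o2.trans o3)))
    have p12 : 0 < X (e 2) - X (e 1) := sub_pos.2 (hXmono o2)
    have hrel : ∀ j : ℤ, d (e 0) * (profile L b C γ θ φ (e 0 + j) -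
        profile L b C γ θ φ (e 2 + (e 1 - e 0) + j)) = -d (e 1) *
        (profile L b C γ θ φ (e 0 + (e 1 - e 0) + j) - profile L b C γ θ φ (e 2 + j)) := by
      intro j
      have h := hst fun k => profile L b C γ θ φ (k + j)
      rw [hsum, hf, hd03, hd12] at h
      rw [show e 2 + (e 1 - e 0) = e 3 by omega, show e 0 + (e 1 - e 0) = e 1 by omega]
      linarith
    have hmin4 : ∀ i ∈ ({e 0, e 0 + (e 1 - e 0), e 2, e 2 + (e 1 - e 0)} : Finset ℤ), ∀ j,
        profile L b C γ θ φ i ≤ profile L b C γ θ φ j := by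
      rw [show e 2 + (e 1 - e 0) = e 3 by omega, show e 0 + (e 1 - e 0) = e 1 by omega]
      intro i hi
      simp only [Finset.mem_insert, Finset.mem_singleton] at hi
      rcases hi with rfl | rfl | rfl | rfl <;> exact hmin _ (het _)
    rcases lt_or_gt_of_ne (hne _ (het 0)) with hneg | hpos
    · refine false_of_parallelogram_relation hL hγC hγ (sub_pos.2 o1) (neg_pos.2 hneg)
        (d := d (e 1)) ?_ hmin4 (fun j => by linarith [hrel j])
      by_contra! h
      nlinarith
    · refine false_of_parallelogram_relation hL hγC hγ (sub_pos.2 o1) hpos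
        (d := -d (e 1)) ?_ hmin4 hrel
      by_contra! h
      nlinarith

end profile

/-! ### Lorentzian geometry -/

section Lorentz

variable {n : ℕ}

theorem lorentz_comm (x y : LVec n) : lorentz x y = lorentz y x := by
  simp only [lorentz, mul_comm]

/-- The Lorentzian product with a fixed vector as a linear map. -/
def lorentzL (u : LVec n) : LVec n →ₗ[ℝ] ℝ where
  toFun := lorentz u
  map_add' x y := by simp only [lorentz, Pi.add_apply, mul_add, Finset.sum_add_distrib]; ring
  map_smul' c x := by
    simp only [lorentz, Pi.smul_apply, smul_eq_mul, RingHom.id_apply, mul_sub, Finset.mul_sum]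
    congr 1
    · exact Finset.sum_congr rfl fun i _ => by ring
    · ring

theorem lorentzL_apply (u x : LVec n) : lorentzL u x = lorentz u x := rfl

theorem lorentz_add_right (u x y : LVec n) : lorentz u (x + y) = lorentz u x + lorentz u y :=
  map_add (lorentzL u) x y

theorem lorentz_sub_right (u x y : LVec n) : lorentz u (x - y) = lorentz u x - lorentz u y :=
  map_sub (lorentzL u) x y

theorem lorentz_smul_right (u : LVec n) (c : ℝ) (x : LVec n) :
    lorentz u (c • x) = c * lorentz u x :=
  map_smul (lorentzL u) c x

theorem lorentz_add_left (x y u : LVec n) : lorentz (x + y) u = lorentz x u + lorentz y u := by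
  rw [lorentz_comm, lorentz_add_right, lorentz_comm u, lorentz_comm u]

theorem lorentz_sub_left (x y u : LVec n) : lorentz (x - y) u = lorentz x u - lorentz y u := by
  rw [lorentz_comm, lorentz_sub_right, lorentz_comm u, lorentz_comm u]

theorem lorentz_smul_left (c : ℝ) (x u : LVec n) : lorentz (c • x) u = c * lorentz x u := by
  rw [lorentz_comm, lorentz_smul_right, lorentz_comm u]

theorem lorentz_neg_left (x u : LVec n) : lorentz (-x) u = -lorentz x u := by
  rw [← neg_one_smul ℝ, lorentz_smul_left, neg_one_mul]

/-- The reverse Cauchy-Schwarz inequality for a timelike and a causal vector. -/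
theorem lorentz_neg_of_mem_futureCone {p q : LVec n} (hp : p ∈ futureCone n)
    (hq : lorentz q q ≤ 0) (hq' : 0 < q (Fin.last n)) : lorentz p q < 0 := by
  obtain ⟨hp1, hp2⟩ := hp
  simp only [lorentz, ← sq] at hp1 hq ⊢
  have hcs := Finset.sum_mul_sq_le_sq_mul_sq Finset.univ (fun i : Fin n => p i.castSucc)
    (fun i => q i.castSucc)
  set S := ∑ i : Fin n, p i.castSucc * q i.castSucc
  set P := ∑ i : Fin n, p i.castSucc ^ 2
  set Q := ∑ i : Fin n, q i.castSucc ^ 2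
  have hP : 0 ≤ P := Finset.sum_nonneg fun i _ => sq_nonneg _
  have hQ : 0 ≤ Q := Finset.sum_nonneg fun i _ => sq_nonneg _
  have hlt : S ^ 2 < (p (Fin.last n) * q (Fin.last n)) ^ 2 := by
    rw [mul_pow]
    have h1 : P * Q ≤ P * q (Fin.last n) ^ 2 := mul_le_mul_of_nonneg_left (by linarith) hP
    have h2 : P * q (Fin.last n) ^ 2 < p (Fin.last n) ^ 2 * q (Fin.last n) ^ 2 :=
      mul_lt_mul_of_pos_right (by linarith) (by positivity)
    linarith
  have := lt_of_pow_lt_pow_left₀ 2 (by positivity) ((sq_abs S).symm ▸ hlt)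
  linarith [le_abs_self S]

theorem mem_futureCone_of_mem_Hyp {p : LVec n} (hp : p ∈ Hyp n) : p ∈ futureCone n :=
  ⟨by rw [hp.1]; norm_num, hp.2⟩

theorem lorentz_lt_neg_one {p q : LVec n} (hp : p ∈ Hyp n) (hq : q ∈ Hyp n) (hne : p ≠ q) :
    lorentz p q < -1 := by
  obtain ⟨hp1, hp2⟩ := hp
  obtain ⟨hq1, hq2⟩ := hq
  simp only [lorentz, ← sq] at hp1 hq1 ⊢
  have hcs := Finset.sum_mul_sq_le_sq_mul_sq Finset.univ (fun i : Fin n => p i.castSucc)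
    (fun i => q i.castSucc)
  have hdiff : ∑ i : Fin n, (p i.castSucc - q i.castSucc) ^ 2 =
      ∑ i : Fin n, p i.castSucc ^ 2 + ∑ i : Fin n, q i.castSucc ^ 2 -
        2 * ∑ i : Fin n, p i.castSucc * q i.castSucc := by
    rw [Finset.mul_sum, ← Finset.sum_add_distrib, ← Finset.sum_sub_distrib]
    exact Finset.sum_congr rfl fun i _ => by ring
  have hpos : 0 < ∑ i : Fin n, (p i.castSucc - q i.castSucc) ^ 2 := by
    refine lt_of_le_of_ne (Finset.sum_nonneg fun i _ => sq_nonneg _) fun h => hne ?_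
    have hz := (Finset.sum_eq_zero_iff_of_nonneg fun i _ => sq_nonneg _).1 h.symm
    have hz' : ∀ i : Fin n, p i.castSucc = q i.castSucc := fun i =>
      sub_eq_zero.1 (pow_eq_zero_iff two_ne_zero |>.1 (hz i (Finset.mem_univ i)))
    have hl : p (Fin.last n) ^ 2 = q (Fin.last n) ^ 2 := by
      have : ∑ i : Fin n, p i.castSucc ^ 2 = ∑ i : Fin n, q i.castSucc ^ 2 := by simp only [hz']
      linarith
    funext i
    refine Fin.lastCases ?_ hz' i
    exact (pow_left_inj₀ hp2.le hq2.le two_ne_zero).1 hl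
  set S := ∑ i : Fin n, p i.castSucc * q i.castSucc
  set P := ∑ i : Fin n, p i.castSucc ^ 2
  set Q := ∑ i : Fin n, q i.castSucc ^ 2
  have hlt : (1 + S) ^ 2 < (p (Fin.last n) * q (Fin.last n)) ^ 2 := by
    rw [mul_pow, show p (Fin.last n) ^ 2 = 1 + P by linarith,
      show q (Fin.last n) ^ 2 = 1 + Q by linarith]
    nlinarith
  have := lt_of_pow_lt_pow_left₀ 2 (by positivity) ((sq_abs (1 + S)).symm ▸ hlt)
  linarith [le_abs_self (1 + S)]

theorem lorentz_le_neg_one {p q : LVec n} (hp : p ∈ Hyp n) (hq : q ∈ Hyp n) :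
    lorentz p q ≤ -1 := by
  by_cases h : p = q
  · rw [h, hq.1]
  · exact (lorentz_lt_neg_one hp hq h).le

theorem hdist_le_hdist_iff {p y y' : LVec n} (hp : p ∈ Hyp n) (hy : y ∈ Hyp n)
    (hy' : y' ∈ Hyp n) : hdist p y ≤ hdist p y' ↔ lorentz y' p ≤ lorentz y p := by
  have h1 := lorentz_le_neg_one hp hy
  have h2 := lorentz_le_neg_one hp hy'
  rw [hdist, hdist, Real.arcosh_le_arcosh (by linarith) (by linarith), neg_le_neg_iff,
    lorentz_comm p, lorentz_comm p]

theorem lorentz_sub_self_pos {p q : LVec n} (hp : p ∈ Hyp n) (hq : q ∈ Hyp n) (hne : p ≠ q) :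
    0 < lorentz (p - q) (p - q) := by
  have := lorentz_lt_neg_one hp hq hne
  rw [lorentz_sub_left, lorentz_sub_right, lorentz_sub_right, hp.1, hq.1, lorentz_comm q p]
  linarith

theorem exists_smul_mem_Hyp {q : LVec n} (hq : q ∈ futureCone n) : ∃ c : ℝ, 0 < c ∧ c • q ∈ Hyp n := by
  obtain ⟨h1, h2⟩ := hq
  have hs : 0 < √(-lorentz q q) := Real.sqrt_pos.2 (by linarith)
  refine ⟨(√(-lorentz q q))⁻¹, inv_pos.2 hs, ?_, ?_⟩
  · rw [lorentz_smul_left, lorentz_smul_right]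
    have := Real.sq_sqrt (show 0 ≤ -lorentz q q by linarith)
    have hne := hs.ne'
    field_simp
    linarith
  · exact mul_pos (inv_pos.2 hs) h2

theorem add_mem_futureCone {p q : LVec n} (hp : p ∈ futureCone n) (hq : q ∈ futureCone n) :
    p + q ∈ futureCone n := by
  refine ⟨?_, add_pos hp.2 hq.2⟩
  have := lorentz_neg_of_mem_futureCone hp hq.1.le hq.2
  rw [lorentz_add_left, lorentz_add_right, lorentz_add_right, lorentz_comm q p]
  linarith [hp.1, hq.1]

/-- A point of hyperbolic space can be moved a little in any direction without violating finitely
many strict linear inequalities. -/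
theorem exists_perturbation {p : LVec n} (hp : p ∈ Hyp n) (v : LVec n) (U : Finset (LVec n))
    (hU : ∀ u ∈ U, lorentz u p < 0) :
    ∃ ε : ℝ, 0 < ε ∧ ∃ c : ℝ, 0 < c ∧ c • (p + ε • v) ∈ Hyp n ∧
      ∀ u ∈ U, lorentz u (c • (p + ε • v)) < 0 := by
  have hcont : ∀ u : LVec n, Filter.Tendsto (fun ε : ℝ => lorentz u (p + ε • v))
      (nhdsWithin 0 (Set.Ioi 0)) (nhds (lorentz u p)) := by
    intro u
    have : Continuous fun ε : ℝ => lorentz u (p + ε • v) := by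
      simp only [lorentz_add_right, lorentz_smul_right]
      fun_prop
    have := this.tendsto 0
    simp only [zero_smul, add_zero] at this
    exact this.mono_left nhdsWithin_le_nhds
  have hself : Filter.Tendsto (fun ε : ℝ => lorentz (p + ε • v) (p + ε • v))
      (nhdsWithin 0 (Set.Ioi 0)) (nhds (lorentz p p)) := by
    have : Continuous fun ε : ℝ => lorentz (p + ε • v) (p + ε • v) := by
      simp only [lorentz_add_right, lorentz_smul_right, lorentz_add_left, lorentz_smul_left]
      fun_prop
    have := this.tendsto 0
    simp only [zero_smul, add_zero] at this
    exact this.mono_left nhdsWithin_le_nhds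
  have hlast : Filter.Tendsto (fun ε : ℝ => (p + ε • v) (Fin.last n))
      (nhdsWithin 0 (Set.Ioi 0)) (nhds (p (Fin.last n))) := by
    have : Continuous fun ε : ℝ => (p + ε • v) (Fin.last n) := by
      simp only [Pi.add_apply, Pi.smul_apply, smul_eq_mul]
      fun_prop
    have := this.tendsto 0
    simp only [zero_smul, add_zero] at this
    exact this.mono_left nhdsWithin_le_nhds
  have hev : ∀ᶠ ε : ℝ in nhdsWithin 0 (Set.Ioi 0), ε ∈ Set.Ioi (0 : ℝ) ∧
      p + ε • v ∈ futureCone n ∧ ∀ u ∈ U, lorentz u (p + ε • v) < 0 := by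
    refine (eventually_mem_nhdsWithin).and (Filter.Eventually.and ?_ ?_)
    · exact (hself.eventually_lt_const (mem_futureCone_of_mem_Hyp hp).1).and
        (hlast.eventually_const_lt hp.2)
    · rw [Filter.eventually_all_finset]
      exact fun u hu => (hcont u).eventually_lt_const (hU u hu)
  obtain ⟨ε, hε, hfut, hneg⟩ := hev.exists
  obtain ⟨c, hc, hcH⟩ := exists_smul_mem_Hyp hfut
  refine ⟨ε, hε, c, hc, hcH, fun u hu => ?_⟩
  rw [lorentz_smul_right]
  exact mul_neg_of_pos_of_neg hc (hneg u hu)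

/-- The Lorentzian product is nondegenerate: it represents every linear functional, in particular
one with prescribed values at linearly independent vectors. -/
theorem exists_lorentz_eq {ι : Type*} {y : ι → LVec n} {I : Set ι} (hI : LinearIndepOn ℝ y I)
    (g : ι → ℝ) : ∃ v : LVec n, ∀ i ∈ I, lorentz (y i) v = g i := by
  obtain ⟨f, hf⟩ := LinearMap.exists_extend
    ((Finsupp.linearCombination ℝ fun i : I => g i) ∘ₗ LinearIndependent.repr hI)
  have hfy : ∀ i ∈ I, f (y i) = g i := by
    intro i hi
    have h := LinearMap.congr_fun hf ⟨y i, Submodule.subset_span ⟨⟨i, hi⟩, rfl⟩⟩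
    have hr := LinearIndependent.repr_eq_single hI ⟨i, hi⟩
      ⟨y i, Submodule.subset_span ⟨⟨i, hi⟩, rfl⟩⟩ rfl
    simp only [LinearMap.comp_apply, hr] at h
    simpa using h
  refine ⟨Fin.snoc (fun i : Fin n => f (Pi.single i.castSucc 1)) (-f (Pi.single (Fin.last n) 1)),
    fun i hi => ?_⟩
  rw [← hfy i hi, LinearMap.pi_apply_eq_sum_univ f (y i), Fin.sum_univ_castSucc, lorentz]
  simp only [Fin.snoc_castSucc, Fin.snoc_last, mul_neg, sub_neg_eq_add, smul_eq_mul]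
  congr 1
  · refine Finset.sum_congr rfl fun j _ => ?_
    congr 2; ext k; simp [Pi.single_apply, eq_comm]
  · congr 2; ext k; simp [Pi.single_apply, eq_comm]

end Lorentz

/-! ### Faces of polyhedra -/

section Faces

variable {n : ℕ}

/-- The point where the segment between two points of hyperbolic space meets the hyperboloid. -/
theorem exists_smul_add_mem_Hyp {p q : LVec n} (hp : p ∈ Hyp n) (hq : q ∈ Hyp n) :
    ∃ c : ℝ, 0 < c ∧ c • (p + q) ∈ Hyp n :=
  exists_smul_mem_Hyp
    (add_mem_futureCone (mem_futureCone_of_mem_Hyp hp) (mem_futureCone_of_mem_Hyp hq))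

/-- The faces of a polyhedron do not depend on its presentation: a face `F` with respect to some
presentation is cut out, in any other one, by the inequalities which are tight at a generic point
`p₀` of `F`. Indeed a point `p` at which these are tight can be joined to a point of the polyhedron
slightly beyond `p₀`, so an inequality which is tight at `p₀` is tight at `p`. -/
theorem IsFace.exists_subset {F P : Set (LVec n)} {S T : Finset (LVec n)} (hF : IsFace F P)
    (hP : IsPresentedBy S T P) :
    ∃ S₁ ⊆ S, F = {p | p ∈ P ∧ ∀ u ∈ S₁, lorentz u p = 0} := by
  classical
  obtain ⟨hne, S', T', S'', hP', hS'', hFeq⟩ := hF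
  obtain ⟨-, -, hPeq⟩ := hP
  obtain ⟨-, -, hPeq'⟩ := hP'
  set act : LVec n → Finset (LVec n) := fun p => S.filter fun u => lorentz u p = 0 with hact
  have hmemP : ∀ {p}, p ∈ P ↔ p ∈ Hyp n ∧ (∀ u ∈ S, lorentz u p ≤ 0) ∧ ∀ u ∈ T, lorentz u p < 0 := by
    intro p; rw [hPeq]; rfl
  have hP'le : ∀ {p}, p ∈ P → ∀ u ∈ S', lorentz u p ≤ 0 := by
    intro p hp; rw [hPeq'] at hp; exact hp.2.1
  have hmemF : ∀ {p}, p ∈ F ↔ p ∈ P ∧ ∀ u ∈ S'', lorentz u p = 0 := by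
    intro p; rw [hFeq]; rfl
  obtain ⟨p₀, hp₀, hmin⟩ := (measure fun p => (act p).card).wf.has_min F hne
  have hp₀P := (hmemF.1 hp₀).1
  have hp₀H := (hmemP.1 hp₀P).1
  refine ⟨act p₀, Finset.filter_subset _ _, Set.ext fun p => ⟨fun hp => ?_, fun hp => ?_⟩⟩
  · obtain ⟨hpP, hp0⟩ := hmemF.1 hp
    refine ⟨hpP, ?_⟩
    obtain ⟨c, hc, hr⟩ := exists_smul_add_mem_Hyp hp₀H (hmemP.1 hpP).1
    have hlor : ∀ u, lorentz u (c • (p₀ + p)) = c * (lorentz u p₀ + lorentz u p) := fun u => by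
      rw [lorentz_smul_right, lorentz_add_right]
    have hrF : c • (p₀ + p) ∈ F := by
      refine hmemF.2 ⟨hmemP.2 ⟨hr, fun u hu => ?_, fun u hu => ?_⟩, fun u hu => ?_⟩
      · rw [hlor]
        have h1 := (hmemP.1 hp₀P).2.1 u hu
        have h2 := (hmemP.1 hpP).2.1 u hu
        exact mul_nonpos_of_nonneg_of_nonpos hc.le (by linarith)
      · rw [hlor]
        have h1 := (hmemP.1 hp₀P).2.2 u hu
        have h2 := (hmemP.1 hpP).2.2 u hu
        exact mul_neg_of_pos_of_neg hc (by linarith)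
      · rw [hlor, (hmemF.1 hp₀).2 u hu, hp0 u hu, add_zero, mul_zero]
    have hsub : ∀ u ∈ act (c • (p₀ + p)), lorentz u p₀ = 0 ∧ lorentz u p = 0 := by
      intro u hu
      obtain ⟨huS, hu0⟩ := Finset.mem_filter.1 hu
      rw [hlor] at hu0
      have h0 := (mul_eq_zero.1 hu0).resolve_left hc.ne'
      have h1 := (hmemP.1 hp₀P).2.1 u huS
      have h2 := (hmemP.1 hpP).2.1 u huS
      constructor <;> linarith
    have hle : act (c • (p₀ + p)) ⊆ act p₀ := fun u hu =>
      Finset.mem_filter.2 ⟨(Finset.mem_filter.1 hu).1, (hsub u hu).1⟩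
    have heq : act (c • (p₀ + p)) = act p₀ :=
      Finset.eq_of_subset_of_card_le hle (not_lt.1 (hmin _ hrF))
    intro u hu
    rw [← heq] at hu
    exact (hsub u hu).2
  · obtain ⟨hpP, hp0⟩ := hp
    obtain ⟨ε, hε, c, hc, hq, hqU⟩ := exists_perturbation hp₀H (p₀ - p)
      ((S.filter fun u => lorentz u p₀ ≠ 0) ∪ T) (by
        intro u hu
        rcases Finset.mem_union.1 hu with hu | hu
        · obtain ⟨huS, hu0⟩ := Finset.mem_filter.1 hu
          exact lt_of_le_of_ne ((hmemP.1 hp₀P).2.1 u huS) hu0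
        · exact (hmemP.1 hp₀P).2.2 u hu)
    have hlor : ∀ u, lorentz u (c • (p₀ + ε • (p₀ - p))) =
        c * (lorentz u p₀ + ε * (lorentz u p₀ - lorentz u p)) := fun u => by
      rw [lorentz_smul_right, lorentz_add_right, lorentz_smul_right, lorentz_sub_right]
    have hqP : c • (p₀ + ε • (p₀ - p)) ∈ P := by
      refine hmemP.2 ⟨hq, fun u hu => ?_, fun u hu => hqU u (Finset.mem_union_right _ hu)⟩
      by_cases hu0 : lorentz u p₀ = 0
      · rw [hlor, hu0, hp0 u (Finset.mem_filter.2 ⟨hu, hu0⟩)]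
        simp
      · exact (hqU u (Finset.mem_union_left _ (Finset.mem_filter.2 ⟨hu, hu0⟩))).le
    refine hmemF.2 ⟨hpP, fun u hu => ?_⟩
    have h1 := hP'le hqP u (hS'' hu)
    have h2 := hP'le hpP u (hS'' hu)
    rw [hlor, (hmemF.1 hp₀).2 u hu, zero_add, zero_sub] at h1
    by_contra hne
    have : 0 < c * (ε * -lorentz u p) :=
      mul_pos hc (mul_pos hε (neg_pos.2 (lt_of_le_of_ne h2 hne)))
    linarith

/-- Converting inequalities to equalities amounts to adding the opposite inequalities. -/
theorem IsPresentedBy.face {P : Set (LVec n)} {S T S' : Finset (LVec n)}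
    (hP : IsPresentedBy S T P) (hS' : S' ⊆ S) :
    ∃ S₁, S ⊆ S₁ ∧ IsPresentedBy S₁ T {p | p ∈ P ∧ ∀ u ∈ S', lorentz u p = 0} ∧
      ∀ u ∈ S₁, u ∈ S ∨ -u ∈ S' := by
  classical
  obtain ⟨hS, hT, hPeq⟩ := hP
  refine ⟨S ∪ S'.image fun u => -u, Finset.subset_union_left, ⟨?_, hT, ?_⟩, ?_⟩
  · intro u hu
    rcases Finset.mem_union.1 hu with hu | hu
    · exact hS u hu
    · obtain ⟨w, hw, rfl⟩ := Finset.mem_image.1 hu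
      rw [lorentz_neg_left, lorentz_comm, lorentz_neg_left, neg_neg]
      exact hS w (hS' hw)
  · ext p
    simp only [hPeq, Set.mem_ofPred_eq]
    constructor
    · rintro ⟨⟨h1, h2, h3⟩, h4⟩
      refine ⟨h1, fun u hu => ?_, h3⟩
      rcases Finset.mem_union.1 hu with hu | hu
      · exact h2 u hu
      · obtain ⟨w, hw, rfl⟩ := Finset.mem_image.1 hu
        rw [lorentz_neg_left, h4 w hw, neg_zero]
    · rintro ⟨h1, h2, h3⟩
      refine ⟨⟨h1, fun u hu => h2 u (Finset.mem_union_left _ hu), h3⟩, fun u hu => ?_⟩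
      have h4 := h2 u (Finset.mem_union_left _ (hS' hu))
      have h5 := h2 (-u) (Finset.mem_union_right _ (Finset.mem_image_of_mem _ hu))
      rw [lorentz_neg_left] at h5
      linarith
  · intro u hu
    rcases Finset.mem_union.1 hu with hu | hu
    · exact Or.inl hu
    · obtain ⟨w, hw, rfl⟩ := Finset.mem_image.1 hu
      exact Or.inr (by rwa [neg_neg])

theorem IsFace.subset {F P : Set (LVec n)} (h : IsFace F P) : F ⊆ P := by
  obtain ⟨-, S, T, S', -, -, rfl⟩ := h
  exact fun p hp => hp.1

theorem IsFace.isPolyhedron {F P : Set (LVec n)} (h : IsFace F P) : IsPolyhedron F := by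
  obtain ⟨-, S, T, S', hP, hS', rfl⟩ := h
  obtain ⟨S₁, -, h1, -⟩ := hP.face hS'
  exact ⟨S₁, T, h1⟩

theorem IsFace.trans {F G P : Set (LVec n)} (hFG : IsFace F G) (hGP : IsFace G P) :
    IsFace F P := by
  classical
  obtain ⟨-, S, T, S', hP, hS', rfl⟩ := hGP
  obtain ⟨S₁, hSS₁, hG, hS₁⟩ := hP.face hS'
  obtain ⟨S₂, hS₂, hF⟩ := hFG.exists_subset hG
  refine ⟨hFG.1, S, T, S' ∪ S₂.filter (· ∈ S), hP, Finset.union_subset hS' ?_, ?_⟩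
  · exact fun u hu => (Finset.mem_filter.1 hu).2
  · rw [hF]
    ext p
    simp only [Set.mem_ofPred_eq]
    constructor
    · rintro ⟨⟨h1, h2⟩, h3⟩
      refine ⟨h1, fun u hu => ?_⟩
      rcases Finset.mem_union.1 hu with hu | hu
      · exact h2 u hu
      · exact h3 u (Finset.mem_filter.1 hu).1
    · rintro ⟨h1, h2⟩
      refine ⟨⟨h1, fun u hu => h2 u (Finset.mem_union_left _ hu)⟩, fun u hu => ?_⟩
      rcases hS₁ u (hS₂ hu) with h | h
      · exact h2 u (Finset.mem_union_right _ (Finset.mem_filter.2 ⟨hu, h⟩))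
      · have := h2 _ (Finset.mem_union_left _ h)
        rw [lorentz_neg_left] at this
        linarith

theorem IsFace.of_subset {F G P : Set (LVec n)} (hF : IsFace F P) (hG : IsFace G P)
    (hFG : F ⊆ G) : IsFace F G := by
  obtain ⟨-, S, T, S', hP, hS', hGeq⟩ := hG
  obtain ⟨S₁, hSS₁, hG', -⟩ := hP.face hS'
  obtain ⟨S₂, hS₂, hFeq⟩ := hF.exists_subset hP
  rw [← hGeq] at hG'
  refine ⟨hF.1, S₁, T, S₂, hG', hS₂.trans hSS₁, Set.ext fun p => ⟨fun hp => ?_, fun hp => ?_⟩⟩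
  · refine ⟨hFG hp, ?_⟩
    rw [hFeq] at hp
    exact hp.2
  · rw [hFeq]
    have h1 := hp.1
    rw [hGeq] at h1
    exact ⟨h1.1, hp.2⟩

end Faces

/-! ### Voronoi complexes in general position -/

section Voronoi

variable {n : ℕ} {ι : Type*}

/-- The indices of the sites nearest to `p`; nearest means largest Lorentzian product. -/
def nearest (y : ι → LVec n) (p : LVec n) : Set ι :=
  {i | ∀ j, lorentz (y j) p ≤ lorentz (y i) p}

/-- The common points of the Voronoi cells of the sites with index in `I`. -/
def commonCell (y : ι → LVec n) (I : Set ι) : Set (LVec n) :=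
  {p | p ∈ Hyp n ∧ I ⊆ nearest y p}

/-- Each Voronoi cell is determined by finitely many sites, in the strong sense that all other
sites are strictly farther from all its points than its own site. -/
def FinitelyDetermined (y : ι → LVec n) : Prop :=
  ∀ i, ∃ N : Finset ι, ∀ p ∈ Hyp n, (∀ k ∈ N, lorentz (y k) p ≤ lorentz (y i) p) →
    ∀ k ∉ N, k ≠ i → lorentz (y k) p < lorentz (y i) p

variable {y : ι → LVec n}

theorem voronoiCell_eq (hy : ∀ i, y i ∈ Hyp n) (i : ι) :
    voronoiCell (Set.range y) (y i) = commonCell y {i} := by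
  ext p
  simp only [voronoiCell, commonCell, Set.mem_ofPred_eq, Set.singleton_subset_iff, nearest,
    Set.forall_mem_range]
  exact and_congr_right fun hp => forall_congr' fun j => hdist_le_hdist_iff hp (hy i) (hy j)

theorem commonCell_anti {I J : Set ι} (h : I ⊆ J) : commonCell y J ⊆ commonCell y I :=
  fun _ hp => ⟨hp.1, h.trans hp.2⟩

theorem nearest_self (hy : ∀ i, y i ∈ Hyp n) (hinj : Function.Injective y) (i : ι) :
    nearest y (y i) = {i} := by
  have h : ∀ j, j ≠ i → lorentz (y j) (y i) < lorentz (y i) (y i) := fun j hj => by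
    rw [(hy i).1]
    exact lorentz_lt_neg_one (hy j) (hy i) (hinj.ne hj)
  ext j
  simp only [Set.mem_singleton_iff]
  constructor
  · intro hj
    by_contra hne
    exact (h j hne).not_ge (hj i)
  · rintro rfl k
    by_cases hk : k = j
    · rw [hk]
    · exact (h k hk).le

theorem lorentz_eq_of_mem_nearest {p : LVec n} {i j : ι} (hi : i ∈ nearest y p)
    (hj : j ∈ nearest y p) : lorentz (y i) p = lorentz (y j) p :=
  le_antisymm (hj i) (hi j)

theorem mem_nearest_of_lorentz_eq {p : LVec n} {i j : ι} (hi : i ∈ nearest y p)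
    (h : lorentz (y j) p = lorentz (y i) p) : j ∈ nearest y p :=
  fun k => h ▸ hi k

theorem nearest_finite (hfin : FinitelyDetermined y) {p : LVec n} (hp : p ∈ Hyp n) :
    (nearest y p).Finite := by
  classical
  rcases (nearest y p).eq_empty_or_nonempty with h | ⟨i, hi⟩
  · rw [h]; exact Set.finite_empty
  · obtain ⟨N, hN⟩ := hfin i
    refine (insert i N).finite_toSet.subset fun k hk => ?_
    by_contra hkN
    simp only [Finset.coe_insert, Set.mem_insert_iff, not_or] at hkN
    exact (hN p hp (fun j _ => hi j) k hkN.2 hkN.1).ne (lorentz_eq_of_mem_nearest hk hi)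

/-- A Voronoi cell is the polyhedron bounded by bisectors with finitely many other sites, and
its faces are its nonempty intersections with other cells. -/
theorem exists_isPresentedBy_commonCell (hy : ∀ i, y i ∈ Hyp n) (hinj : Function.Injective y)
    (hfin : FinitelyDetermined y) (i : ι) :
    ∃ S : Finset (LVec n), IsPresentedBy S ∅ (commonCell y {i}) ∧
      (∀ u ∈ S, ∃ k, u = y k - y i) ∧
      ∀ p ∈ commonCell y {i}, ∀ k ∈ nearest y p, k ≠ i → y k - y i ∈ S := by
  classical
  obtain ⟨N, hN⟩ := hfin i
  refine ⟨(N.erase i).image fun k => y k - y i, ⟨?_, by simp, ?_⟩, ?_, ?_⟩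
  · intro u hu
    obtain ⟨k, hk, rfl⟩ := Finset.mem_image.1 hu
    exact lorentz_sub_self_pos (hy k) (hy i) (hinj.ne (Finset.ne_of_mem_erase hk))
  · ext p
    simp only [commonCell, Set.mem_ofPred_eq, Set.singleton_subset_iff, Finset.notMem_empty,
      false_imp_iff, implies_true, and_true]
    refine and_congr_right fun hp => ⟨fun h u hu => ?_, fun h => ?_⟩
    · obtain ⟨k, hk, rfl⟩ := Finset.mem_image.1 hu
      rw [lorentz_sub_left]
      exact sub_nonpos.2 (h k)
    · have h' : ∀ k ∈ N, lorentz (y k) p ≤ lorentz (y i) p := by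
        intro k hk
        by_cases hki : k = i
        · rw [hki]
        · have := h _ (Finset.mem_image_of_mem _ (Finset.mem_erase.2 ⟨hki, hk⟩))
          rw [lorentz_sub_left] at this
          exact sub_nonpos.1 this
      intro k
      by_cases hk : k ∈ N
      · exact h' k hk
      · by_cases hki : k = i
        · rw [hki]
        · exact (hN p hp h' k hk hki).le
  · intro u hu
    obtain ⟨k, -, rfl⟩ := Finset.mem_image.1 hu
    exact ⟨k, rfl⟩
  · rintro p ⟨hp, hpi⟩ k hk hki
    rw [Set.singleton_subset_iff] at hpi
    refine Finset.mem_image_of_mem _ (Finset.mem_erase.2 ⟨hki, ?_⟩)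
    by_contra hkN
    exact (hN p hp (fun j _ => hpi j) k hkN hki).ne (lorentz_eq_of_mem_nearest hk hpi)

theorem isFace_commonCell_singleton_iff (hy : ∀ i, y i ∈ Hyp n) (hinj : Function.Injective y)
    (hfin : FinitelyDetermined y) {i : ι} {F : Set (LVec n)} :
    IsFace F (commonCell y {i}) ↔ F.Nonempty ∧ ∃ I : Set ι, i ∈ I ∧ F = commonCell y I := by
  classical
  obtain ⟨S, hS, hSy, hSn⟩ := exists_isPresentedBy_commonCell hy hinj hfin i
  have hmem : ∀ {p}, p ∈ commonCell y {i} ↔ p ∈ Hyp n ∧ i ∈ nearest y p := by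
    simp [commonCell]
  constructor
  · intro hF
    refine ⟨hF.1, ?_⟩
    obtain ⟨S₁, hS₁, rfl⟩ := hF.exists_subset hS
    refine ⟨insert i {k | y k - y i ∈ S₁}, Set.mem_insert _ _, ?_⟩
    ext p
    simp only [Set.mem_ofPred_eq, commonCell, Set.insert_subset_iff,
      Set.singleton_subset_iff, and_assoc]
    refine and_congr_right fun hp => and_congr_right fun hi => ⟨fun h k hk => ?_, fun h u hu => ?_⟩
    · have := h _ hk
      rw [lorentz_sub_left] at this
      exact mem_nearest_of_lorentz_eq hi (sub_eq_zero.1 this)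
    · obtain ⟨k, rfl⟩ := hSy u (hS₁ hu)
      rw [lorentz_sub_left, lorentz_eq_of_mem_nearest (h hu) hi, sub_self]
  · rintro ⟨⟨q, hq⟩, I, hiI, rfl⟩
    refine ⟨⟨q, hq⟩, S, ∅, S.filter fun u => ∃ k ∈ I, u = y k - y i, hS, Finset.filter_subset _ _, ?_⟩
    ext p
    constructor
    · intro hp
      refine ⟨commonCell_anti (Set.singleton_subset_iff.2 hiI) hp, fun u hu => ?_⟩
      obtain ⟨-, k, hk, rfl⟩ := Finset.mem_filter.1 hu
      rw [lorentz_sub_left, lorentz_eq_of_mem_nearest (hp.2 hk) (hp.2 hiI), sub_self]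
    · rintro ⟨hp, hp0⟩
      obtain ⟨hpH, hpi⟩ := hmem.1 hp
      refine ⟨hpH, fun k hk => ?_⟩
      by_cases hki : k = i
      · rwa [hki]
      · have hkS := hSn q (hmem.2 ⟨hq.1, hq.2 hiI⟩) k (hq.2 hk) hki
        have := hp0 _ (Finset.mem_filter.2 ⟨hkS, k, hk, rfl⟩)
        rw [lorentz_sub_left] at this
        exact mem_nearest_of_lorentz_eq hpi (sub_eq_zero.1 this)

theorem mem_voronoiComplex_iff (hy : ∀ i, y i ∈ Hyp n) (hinj : Function.Injective y)
    (hfin : FinitelyDetermined y) {c : Set (LVec n)} :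
    c ∈ voronoiComplex (Set.range y) ↔
      c.Nonempty ∧ ∃ I : Set ι, I.Nonempty ∧ c = commonCell y I := by
  simp only [voronoiComplex, Set.mem_ofPred_eq, Set.exists_range_iff, voronoiCell_eq hy,
    isFace_commonCell_singleton_iff hy hinj hfin]
  constructor
  · rintro ⟨i, rfl | ⟨hne, I, hi, rfl⟩⟩
    · exact ⟨⟨y i, hy i, by rw [nearest_self hy hinj]⟩, {i}, Set.singleton_nonempty i, rfl⟩
    · exact ⟨hne, I, ⟨i, hi⟩, rfl⟩
  · rintro ⟨hne, I, ⟨i, hi⟩, rfl⟩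
    exact ⟨i, Or.inr ⟨hne, I, hi, rfl⟩⟩

/-- Incidence in a Voronoi complex is inclusion. -/
theorem isFace_iff_subset (hy : ∀ i, y i ∈ Hyp n) (hinj : Function.Injective y)
    (hfin : FinitelyDetermined y) {c c' : Set (LVec n)} (hc : c ∈ voronoiComplex (Set.range y))
    (hc' : c' ∈ voronoiComplex (Set.range y)) : IsFace c c' ↔ c ⊆ c' := by
  refine ⟨IsFace.subset, fun h => ?_⟩
  obtain ⟨hne, I, -, rfl⟩ := (mem_voronoiComplex_iff hy hinj hfin).1 hc
  obtain ⟨hne', I', ⟨i, hi⟩, rfl⟩ := (mem_voronoiComplex_iff hy hinj hfin).1 hc'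
  refine IsFace.of_subset (P := commonCell y {i})
    ((isFace_commonCell_singleton_iff hy hinj hfin).2 ⟨hne, insert i I, Set.mem_insert _ _, ?_⟩)
    ((isFace_commonCell_singleton_iff hy hinj hfin).2 ⟨hne', I', hi, rfl⟩) h
  refine Set.Subset.antisymm (fun p hp => ⟨hp.1, ?_⟩) (commonCell_anti (Set.subset_insert _ _))
  exact Set.insert_subset ((h hp).2 hi) hp.2

/-- A point can be moved so that it stays on the bisectors of any of its nearest sites, provided
that it does not get nearer to the other ones; no further sites become nearest. -/
theorem exists_nearest_perturbation (hfin : FinitelyDetermined y) {p : LVec n} (hp : p ∈ Hyp n)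
    {i : ι} (hi : i ∈ nearest y p) {v : LVec n}
    (hv : ∀ k ∈ nearest y p, lorentz (y k) v ≤ lorentz (y i) v) :
    ∃ ε : ℝ, 0 < ε ∧ ∃ c : ℝ, 0 < c ∧ c • (p + ε • v) ∈ Hyp n ∧
      ∀ k, k ∈ nearest y (c • (p + ε • v)) ↔
        k ∈ nearest y p ∧ lorentz (y k) v = lorentz (y i) v := by
  classical
  obtain ⟨N, hN⟩ := hfin i
  obtain ⟨ε, hε, c, hc, hq, hqU⟩ := exists_perturbation hp v
    ((N.filter (· ∉ nearest y p)).image fun k => y k - y i) (by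
      intro u hu
      obtain ⟨k, hk, rfl⟩ := Finset.mem_image.1 hu
      have hk' := (Finset.mem_filter.1 hk).2
      rw [lorentz_sub_left]
      exact sub_neg.2 (lt_of_le_of_ne (hi k) fun h => hk' (mem_nearest_of_lorentz_eq hi h)))
  refine ⟨ε, hε, c, hc, hq, ?_⟩
  set q := c • (p + ε • v) with hqdef
  have hmem : ∀ k ∈ nearest y p,
      lorentz (y k) q - lorentz (y i) q = c * (ε * (lorentz (y k) v - lorentz (y i) v)) := by
    intro k hk
    rw [hqdef, lorentz_smul_right, lorentz_smul_right, lorentz_add_right, lorentz_add_right,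
      lorentz_smul_right, lorentz_smul_right, lorentz_eq_of_mem_nearest hk hi]
    ring
  have hnot : ∀ k ∈ N, k ∉ nearest y p → lorentz (y k) q < lorentz (y i) q := by
    intro k hk hkn
    have := hqU _ (Finset.mem_image_of_mem _ (Finset.mem_filter.2 ⟨hk, hkn⟩))
    rw [lorentz_sub_left] at this
    exact sub_neg.1 this
  have hNle : ∀ k ∈ N, lorentz (y k) q ≤ lorentz (y i) q := by
    intro k hk
    by_cases hkn : k ∈ nearest y p
    · rw [← sub_nonpos, hmem k hkn]
      exact mul_nonpos_of_nonneg_of_nonpos hc.le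
        (mul_nonpos_of_nonneg_of_nonpos hε.le (sub_nonpos.2 (hv k hkn)))
    · exact (hnot k hk hkn).le
  have hlt : ∀ k, k ∉ nearest y p → lorentz (y k) q < lorentz (y i) q := by
    intro k hkn
    by_cases hk : k ∈ N
    · exact hnot k hk hkn
    · exact hN q hq hNle k hk fun h => hkn (h ▸ hi)
  have hiq : i ∈ nearest y q := by
    intro k
    by_cases hk : k ∈ N
    · exact hNle k hk
    · by_cases hki : k = i
      · rw [hki]
      · exact (hN q hq hNle k hk hki).le
  intro k
  constructor
  · intro hk
    have heq := lorentz_eq_of_mem_nearest hk hiq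
    have hkp : k ∈ nearest y p := by
      by_contra hkp
      exact (hlt k hkp).ne heq
    refine ⟨hkp, ?_⟩
    have := hmem k hkp
    rw [heq, sub_self] at this
    have := (mul_eq_zero.1 this.symm).resolve_left hc.ne'
    exact sub_eq_zero.1 ((mul_eq_zero.1 this).resolve_left hε.ne')
  · rintro ⟨hkp, hkv⟩
    refine mem_nearest_of_lorentz_eq hiq (sub_eq_zero.1 ?_)
    rw [hmem k hkp, hkv, sub_self, mul_zero, mul_zero]

/-- If the sites nearest to any point are linearly independent, then the common points of `|I|`
Voronoi cells form a polyhedron of codimension `|I| - 1`, as soon as there are any. -/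
theorem hasDim_commonCell (hfin : FinitelyDetermined y)
    (hind : ∀ p ∈ Hyp n, LinearIndepOn ℝ y (nearest y p)) {p : LVec n} (hp : p ∈ Hyp n)
    {I : Finset ι} (hI : (I : Set ι) ⊆ nearest y p) {i : ι} (hi : i ∈ I) {j : ℕ}
    (hj : I.card + j = n + 1) : HasDim (commonCell y I) j := by
  classical
  -- a point `q` whose nearest sites are exactly the given ones
  obtain ⟨q, hq, hqI⟩ : ∃ q ∈ Hyp n, nearest y q = I := by
    obtain ⟨v, hv⟩ := exists_lorentz_eq (hind p hp) (fun k => if k ∈ I then 0 else -1)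
    have hvi : lorentz (y i) v = 0 := by rw [hv i (hI hi), if_pos hi]
    obtain ⟨ε, -, c, -, hq, hqn⟩ := exists_nearest_perturbation hfin hp (hI hi) (v := v) (by
      intro k hk
      rw [hv k hk, hvi]
      split_ifs <;> norm_num)
    refine ⟨_, hq, Set.ext fun k => ?_⟩
    rw [hqn k, hvi, Finset.mem_coe]
    constructor
    · rintro ⟨hk, hkv⟩
      by_contra hkI
      rw [hv k hk, if_neg hkI] at hkv
      norm_num at hkv
    · intro hk
      exact ⟨hI hk, by rw [hv k (hI hk), if_pos hk]⟩
  set Λ : LVec n →ₗ[ℝ] ({k // k ∈ I.erase i} → ℝ) :=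
    LinearMap.pi fun k => lorentzL (y k - y i) with hΛ
  have hΛmem : ∀ w, w ∈ LinearMap.ker Λ ↔ ∀ k ∈ I, lorentz (y k) w = lorentz (y i) w := by
    intro w
    rw [LinearMap.mem_ker, funext_iff]
    simp only [hΛ, LinearMap.pi_apply, lorentzL_apply, lorentz_sub_left, Pi.zero_apply,
      Subtype.forall, Finset.mem_erase, sub_eq_zero]
    constructor
    · intro h k hk
      by_cases hki : k = i
      · rw [hki]
      · exact h k ⟨hki, hk⟩
    · exact fun h k hk => h k hk.2
  have hsurj : Function.Surjective Λ := by
    intro g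
    have hIind : LinearIndepOn ℝ y I := (hind p hp).mono hI
    obtain ⟨w, hw⟩ := exists_lorentz_eq hIind fun k => if h : k ∈ I.erase i then g ⟨k, h⟩ else 0
    refine ⟨w, funext fun k => ?_⟩
    have hk := k.2
    simp only [hΛ, LinearMap.pi_apply, lorentzL_apply, lorentz_sub_left]
    rw [hw k (Finset.mem_of_mem_erase hk), hw i hi, dif_pos hk, dif_neg (by simp), sub_zero]
  have hspan : Submodule.span ℝ (commonCell y I) = LinearMap.ker Λ := by
    apply le_antisymm
    · rw [Submodule.span_le]
      intro r hr
      rw [SetLike.mem_coe, hΛmem]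
      exact fun k hk => lorentz_eq_of_mem_nearest (hr.2 hk) (hr.2 hi)
    · intro w hw
      rw [hΛmem] at hw
      have hqi : i ∈ nearest y q := by rw [hqI]; exact hi
      obtain ⟨ε, hε, c, hc, hr, hrn⟩ := exists_nearest_perturbation hfin hq hqi (v := w) (by
        intro k hk
        rw [hqI] at hk
        exact (hw k hk).le)
      have hrmem : c • (q + ε • w) ∈ Submodule.span ℝ (commonCell y I) := by
        refine Submodule.subset_span ⟨hr, fun k hk => (hrn k).2 ⟨by rwa [hqI], hw k hk⟩⟩
      have hqmem : q ∈ Submodule.span ℝ (commonCell y I) :=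
        Submodule.subset_span ⟨hq, hqI.ge⟩
      have h1 := (Submodule.smul_mem_iff _ hc.ne').1 hrmem
      have h2 := (Submodule.add_mem_iff_right _ hqmem).1 h1
      exact (Submodule.smul_mem_iff _ hε.ne').1 h2
  have hrank := LinearMap.finrank_range_add_finrank_ker Λ
  rw [LinearMap.range_eq_top.2 hsurj, finrank_top, Module.finrank_fintype_fun_eq_card,
    Module.finrank_fintype_fun_eq_card, Fintype.card_coe, Fintype.card_fin,
    Finset.card_erase_of_mem hi] at hrank
  rw [HasDim, hspan]
  have := Finset.card_pos.2 ⟨i, hi⟩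
  omega

theorem commonCell_singleton_mem (hy : ∀ i, y i ∈ Hyp n) (hinj : Function.Injective y)
    (hfin : FinitelyDetermined y) (i : ι) : commonCell y {i} ∈ voronoiComplex (Set.range y) :=
  (mem_voronoiComplex_iff hy hinj hfin).2
    ⟨⟨y i, hy i, by rw [nearest_self hy hinj]⟩, {i}, Set.singleton_nonempty i, rfl⟩

/-- Voronoi cells are maximal: the site of a cell is in no other cell. -/
theorem eq_of_commonCell_singleton_subset (hy : ∀ i, y i ∈ Hyp n) (hinj : Function.Injective y)
    {i : ι} {I : Set ι} (hI : I.Nonempty) (h : commonCell y {i} ⊆ commonCell y I) : I = {i} := by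
  have h1 : y i ∈ commonCell y I := h ⟨hy i, by rw [nearest_self hy hinj]⟩
  have h2 := h1.2
  rw [nearest_self hy hinj] at h2
  exact (Set.Nonempty.subset_singleton_iff hI).1 h2

theorem commonCell_singleton_injective (hy : ∀ i, y i ∈ Hyp n) (hinj : Function.Injective y) :
    Function.Injective fun i => commonCell y {i} := by
  intro i j hij
  have h : commonCell y {i} = commonCell y {j} := hij
  have := eq_of_commonCell_singleton_subset hy hinj (Set.singleton_nonempty j) h.subset
  exact (Set.singleton_eq_singleton_iff.1 this).symm

/-- A subcomplex which contains the Voronoi cells of the sites in `J` and whose members are all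
contained in these cells has these cells as its facets. -/
theorem facets_eq (hy : ∀ i, y i ∈ Hyp n) (hinj : Function.Injective y)
    (hfin : FinitelyDetermined y) {C : Set (Set (LVec n))} {J : Set ι}
    (hC : C ⊆ voronoiComplex (Set.range y)) (hJ : ∀ i ∈ J, commonCell y {i} ∈ C)
    (hCJ : ∀ c ∈ C, ∃ i ∈ J, c ⊆ commonCell y {i}) :
    facets C = (fun i => commonCell y {i}) '' J := by
  ext c
  constructor
  · rintro ⟨hc, hmax⟩
    obtain ⟨i, hi, hci⟩ := hCJ c hc
    exact ⟨i, hi, (hmax _ (hJ i hi)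
      ((isFace_iff_subset hy hinj hfin (hC hc) (hC (hJ i hi))).2 hci)).symm⟩
  · rintro ⟨i, hi, rfl⟩
    refine ⟨hJ i hi, fun c' hc' hface => ?_⟩
    obtain ⟨-, I, hI, rfl⟩ := (mem_voronoiComplex_iff hy hinj hfin).1 (hC hc')
    rw [eq_of_commonCell_singleton_subset hy hinj hI hface.subset]

theorem isPolyhedralComplex_voronoiComplex (hy : ∀ i, y i ∈ Hyp n) (hinj : Function.Injective y)
    (hfin : FinitelyDetermined y) : IsPolyhedralComplex (voronoiComplex (Set.range y)) := by
  have hface : ∀ c ∈ voronoiComplex (Set.range y), ∃ i, IsFace c (commonCell y {i}) := by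
    intro c hc
    obtain ⟨hne, I, ⟨i, hi⟩, rfl⟩ := (mem_voronoiComplex_iff hy hinj hfin).1 hc
    exact ⟨i, (isFace_commonCell_singleton_iff hy hinj hfin).2 ⟨hne, I, hi, rfl⟩⟩
  refine ⟨fun c hc => ?_, fun c hc F hF => ?_⟩
  · obtain ⟨i, hi⟩ := hface c hc
    exact ⟨hi.isPolyhedron, hi.1⟩
  · obtain ⟨i, hi⟩ := hface c hc
    obtain ⟨hne, I, hiI, rfl⟩ := (isFace_commonCell_singleton_iff hy hinj hfin).1 (hF.trans hi)
    exact (mem_voronoiComplex_iff hy hinj hfin).2 ⟨hne, I, ⟨i, hiI⟩, rfl⟩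

/-- The Voronoi complex of sites in general position is simple. -/
theorem isSimpleComplex_voronoiComplex [Nonempty ι] (hy : ∀ i, y i ∈ Hyp n)
    (hinj : Function.Injective y) (hfin : FinitelyDetermined y)
    (hind : ∀ p ∈ Hyp n, LinearIndepOn ℝ y (nearest y p)) :
    IsSimpleComplex (voronoiComplex (Set.range y)) := by
  classical
  have hmem := @mem_voronoiComplex_iff n ι y hy hinj hfin
  have hcell := commonCell_singleton_mem hy hinj hfin
  refine ⟨isPolyhedralComplex_voronoiComplex hy hinj hfin, ⟨⟨_, hcell (Classical.arbitrary ι)⟩, ?_⟩,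
    ?_⟩
  · rw [facets_eq hy hinj hfin (J := Set.univ) subset_rfl (fun i _ => hcell i)]
    · rintro _ ⟨i, -, rfl⟩
      have := hasDim_commonCell hfin hind (hy i) (I := {i}) (i := i) (j := n)
        (by rw [nearest_self hy hinj]; simp) (Finset.mem_singleton_self i)
        (by rw [Finset.card_singleton, add_comm])
      simpa using this
    · intro c hc
      obtain ⟨-, I, ⟨i, hi⟩, rfl⟩ := hmem.1 hc
      exact ⟨i, Set.mem_univ i, commonCell_anti (Set.singleton_subset_iff.2 hi)⟩
  · intro k hk c hc hdim
    obtain ⟨⟨p, hp⟩, I₀, ⟨i₀, hi₀⟩, hcI₀⟩ := hmem.1 hc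
    -- `J` is the set of all sites whose cell contains `c`
    obtain ⟨J, hJ⟩ : ∃ J : Finset ι, ∀ i, i ∈ J ↔ c ⊆ commonCell y {i} := by
      have hfinJ : {i | c ⊆ commonCell y {i}}.Finite :=
        (nearest_finite hfin (hcI₀ ▸ hp : p ∈ commonCell y I₀).1).subset fun i hi =>
          Set.singleton_subset_iff.1 (hi hp).2
      exact ⟨hfinJ.toFinset, fun i => by simp⟩
    have hI₀J : I₀ ⊆ J := fun i hi => (hJ i).2 (by
      rw [hcI₀]; exact commonCell_anti (Set.singleton_subset_iff.2 hi))
    have hcJ : c = commonCell y J := by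
      refine Set.Subset.antisymm (fun q hq => ?_) ?_
      · exact ⟨(hcI₀ ▸ hq : q ∈ commonCell y I₀).1, fun i hi =>
          Set.singleton_subset_iff.1 ((hJ i).1 hi hq).2⟩
      · rw [hcI₀]; exact commonCell_anti hI₀J
    have hpJ : p ∈ commonCell y J := hcJ ▸ hp
    have hJcard : J.card = n - k + 1 := by
      have hJind : LinearIndepOn ℝ y J := (hind p hpJ.1).mono hpJ.2
      have hle : J.card ≤ n + 1 := by
        have := (show LinearIndependent ℝ fun i : J => y i from hJind).fintype_card_le_finrank
        simpa using this
      have := hasDim_commonCell hfin hind hpJ.1 hpJ.2 (hI₀J hi₀) (j := n + 1 - J.card) (by omega)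
      rw [← hcJ] at this
      rw [HasDim] at this hdim
      have := Finset.card_pos.2 ⟨i₀, hI₀J hi₀⟩
      omega
    set R := residue (voronoiComplex (Set.range y)) c with hR
    have hRC : R ⊆ voronoiComplex (Set.range y) := fun d hd => hd.1
    -- the cell of every nonempty subset of `J` is in the residue
    have hRmem : ∀ I : Finset ι, I ⊆ J → I.Nonempty → commonCell y I ∈ R := by
      intro I hIJ hIne
      have hIC : commonCell y I ∈ voronoiComplex (Set.range y) :=
        hmem.2 ⟨⟨p, commonCell_anti (Finset.coe_subset.2 hIJ) hpJ⟩, I, hIne, rfl⟩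
      refine ⟨hIC, commonCell y I, hIC, ?_, ?_⟩
      · rw [isFace_iff_subset hy hinj hfin hc hIC, hcJ]
        exact commonCell_anti (Finset.coe_subset.2 hIJ)
      · rw [isFace_iff_subset hy hinj hfin hIC hIC]
    have hRcell : ∀ i ∈ J, commonCell y {i} ∈ R := fun i hi => by
      have := hRmem {i} (Finset.singleton_subset_iff.2 hi) (Finset.singleton_nonempty i)
      rwa [Finset.coe_singleton] at this
    have hfac : facets R = (fun i => commonCell y {i}) '' J := by
      refine facets_eq hy hinj hfin hRC hRcell ?_
      rintro d ⟨hd, c', hc', hcc', hdc'⟩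
      obtain ⟨-, I, ⟨i, hi⟩, rfl⟩ := hmem.1 hc'
      have hi' : commonCell y I ⊆ commonCell y {i} :=
        commonCell_anti (Set.singleton_subset_iff.2 hi)
      exact ⟨i, (hJ i).2 (hcc'.subset.trans hi'), hdc'.subset.trans hi'⟩
    have hcellinj := commonCell_singleton_injective hy hinj
    let e : Fin (n - k + 1) ≃ J := (Fintype.equivFinOfCardEq (by simpa using hJcard)).symm
    have hrange : Set.range (fun x => commonCell y {((e x : J) : ι)}) = facets R := by
      rw [hfac]
      ext d
      constructor
      · rintro ⟨x, rfl⟩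
        exact ⟨_, (e x).2, rfl⟩
      · rintro ⟨i, hi, rfl⟩
        exact ⟨e.symm ⟨i, hi⟩, by simp⟩
    refine ⟨fun x => commonCell y {((e x : J) : ι)}, ?_, hrange, fun s => ?_⟩
    · exact fun x x' h => e.injective (Subtype.ext (hcellinj h))
    rw [hrange]
    constructor
    · rintro ⟨hs, m, j, hcard, -⟩
      exact ⟨Finset.card_pos.1 (by omega), hs⟩
    · rintro ⟨hne, hs⟩
      refine ⟨hs, ?_⟩
      rw [hfac] at hs
      obtain ⟨I, hIJ, rfl⟩ := Finset.subset_set_image_iff.1 hs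
      rw [Finset.coe_subset] at hIJ
      rw [Finset.image_nonempty] at hne
      obtain ⟨i, hi⟩ := hne
      have hpos := Finset.card_pos.2 ⟨i, hi⟩
      have hle := Finset.card_le_card hIJ
      refine ⟨I.card - 1, n + 1 - I.card, ?_, by omega, commonCell y I, hRmem I hIJ ⟨i, hi⟩, ?_, ?_⟩
      · rw [Finset.card_image_of_injective _ hcellinj]; omega
      · exact hasDim_commonCell hfin hind hpJ.1 ((Finset.coe_subset.2 hIJ).trans hpJ.2) hi (by omega)
      · intro d hd
        obtain ⟨i', hi', rfl⟩ := Finset.mem_image.1 hd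
        rw [isFace_iff_subset hy hinj hfin (hRC (hRmem I hIJ ⟨i, hi⟩)) (hcell i')]
        exact commonCell_anti (Set.singleton_subset_iff.2 hi')

end Voronoi

/-! ### Normal form of a loxodromic -/

section Frame

/-- The linear action of an invertible matrix. -/
def act {n : ℕ} (A : GL (Fin (n + 1)) ℝ) (x : LVec n) : LVec n :=
  (A : Matrix (Fin (n + 1)) (Fin (n + 1)) ℝ).mulVec x

theorem act_add {n : ℕ} (A : GL (Fin (n + 1)) ℝ) (x y : LVec n) :
    act A (x + y) = act A x + act A y := Matrix.mulVec_add _ _ _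

theorem act_smul {n : ℕ} (A : GL (Fin (n + 1)) ℝ) (c : ℝ) (x : LVec n) :
    act A (c • x) = c • act A x := Matrix.mulVec_smul _ _ _

theorem act_mul {n : ℕ} (A B : GL (Fin (n + 1)) ℝ) (x : LVec n) :
    act (A * B) x = act A (act B x) := by
  simp only [act, Units.val_mul, Matrix.mulVec_mulVec]

theorem act_one {n : ℕ} (x : LVec n) : act 1 x = x := by simp [act]

theorem act_injective {n : ℕ} (A : GL (Fin (n + 1)) ℝ) : Function.Injective (act A) := by
  intro x y h
  have := congrArg (act A⁻¹) h
  rwa [← act_mul, ← act_mul, inv_mul_cancel, act_one, act_one] at this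

/-- A frame of `ℝ^{3,1}` consisting of null vectors `e₁`, `e₂` and of an orthonormal basis `w₁`, `w₂`
of their orthogonal complement, with respect to which `A` is the translation by `L` along the axis
with ends `e₁`, `e₂`, composed with the rotation by `θ` around it. -/
structure IsAxisFrame (A : GL (Fin (3 + 1)) ℝ) (e₁ e₂ w₁ w₂ : LVec 3) (L θ : ℝ) : Prop where
  e₁_mem : e₁ ∈ futureNull 3
  e₂_mem : e₂ ∈ futureNull 3
  e₁_e₂ : lorentz e₁ e₂ < 0
  e₁_w₁ : lorentz e₁ w₁ = 0
  e₁_w₂ : lorentz e₁ w₂ = 0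
  e₂_w₁ : lorentz e₂ w₁ = 0
  e₂_w₂ : lorentz e₂ w₂ = 0
  w₁_w₁ : lorentz w₁ w₁ = 1
  w₂_w₂ : lorentz w₂ w₂ = 1
  w₁_w₂ : lorentz w₁ w₂ = 0
  exists_coord : ∀ x : LVec 3, ∃ a b c d : ℝ, x = a • e₁ + b • e₂ + c • w₁ + d • w₂
  act_e₁ : act A e₁ = Real.exp L • e₁
  act_e₂ : act A e₂ = Real.exp (-L) • e₂
  act_w₁ : act A w₁ = Real.cos θ • w₁ + Real.sin θ • w₂
  act_w₂ : act A w₂ = -Real.sin θ • w₁ + Real.cos θ • w₂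

theorem lorentz_neg_of_mem_futureNull {n : ℕ} {e₁ e₂ : LVec n} (h₁ : e₁ ∈ futureNull n)
    (h₂ : e₂ ∈ futureNull n) (hind : LinearIndependent ℝ ![e₁, e₂]) : lorentz e₁ e₂ < 0 := by
  obtain ⟨h1, h1'⟩ := h₁
  obtain ⟨h2, h2'⟩ := h₂
  -- the combination of `e₁` and `e₂` with vanishing time coordinate is spacelike
  set v := e₂ (Fin.last n) • e₁ - e₁ (Fin.last n) • e₂ with hv
  have hvl : v (Fin.last n) = 0 := by simp [hv, mul_comm]
  have hvv : lorentz v v = -2 * (e₁ (Fin.last n) * e₂ (Fin.last n)) * lorentz e₁ e₂ := by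
    simp only [hv, lorentz_sub_left, lorentz_sub_right, lorentz_smul_left, lorentz_smul_right, h1,
      h2, lorentz_comm e₂ e₁]
    ring
  have hsum : lorentz v v = ∑ i : Fin n, v i.castSucc ^ 2 := by
    rw [lorentz, hvl]; simp [sq]
  have hnonneg : 0 ≤ ∑ i : Fin n, v i.castSucc ^ 2 := Finset.sum_nonneg fun i _ => sq_nonneg _
  have hll := mul_pos h1' h2'
  by_contra! h
  have hz : ∑ i : Fin n, v i.castSucc ^ 2 = 0 := by
    refine le_antisymm ?_ hnonneg
    rw [← hsum, hvv]
    nlinarith [mul_nonneg hll.le h]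
  have hz' := (Finset.sum_eq_zero_iff_of_nonneg fun i _ => sq_nonneg _).1 hz
  have hv0 : v = 0 := by
    funext i
    refine Fin.lastCases hvl (fun j => ?_) i
    exact pow_eq_zero_iff two_ne_zero |>.1 (hz' j (Finset.mem_univ j))
  have := (LinearIndependent.pair_iff.1 hind) (e₂ (Fin.last n)) (-e₁ (Fin.last n)) (by
    rw [neg_smul, ← sub_eq_add_neg]; exact hv0)
  exact h2'.ne' this.1

/-- The orthogonal complement of a timelike vector is spacelike. -/
theorem lorentz_self_pos_of_orthogonal {n : ℕ} {t w : LVec n} (ht : t ∈ futureCone n)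
    (hw : w ≠ 0) (htw : lorentz t w = 0) : 0 < lorentz w w := by
  by_contra! h
  rcases lt_trichotomy (w (Fin.last n)) 0 with hl | hl | hl
  · have := lorentz_neg_of_mem_futureCone ht (q := -w)
      (by rw [lorentz_neg_left, lorentz_comm, lorentz_neg_left, neg_neg]; exact h)
      (neg_pos.2 hl)
    rw [lorentz_comm, lorentz_neg_left, lorentz_comm, htw] at this
    simp at this
  · have hsum : lorentz w w = ∑ i : Fin n, w i.castSucc ^ 2 := by
      rw [lorentz, hl]; simp [sq]
    have hnonneg : 0 ≤ ∑ i : Fin n, w i.castSucc ^ 2 := Finset.sum_nonneg fun i _ => sq_nonneg _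
    have hz := (Finset.sum_eq_zero_iff_of_nonneg fun i _ => sq_nonneg _).1
      (le_antisymm (hsum ▸ h) hnonneg)
    refine hw (funext fun i => Fin.lastCases hl (fun j => ?_) i)
    exact pow_eq_zero_iff two_ne_zero |>.1 (hz j (Finset.mem_univ j))
  · exact (lorentz_neg_of_mem_futureCone ht h hl).ne htw

/-- A unit vector orthogonal to a timelike vector and to at most two further vectors. -/
theorem exists_unit_orthogonal {t u v : LVec 3} (ht : t ∈ futureCone 3) :
    ∃ w : LVec 3, lorentz w w = 1 ∧ lorentz t w = 0 ∧ lorentz u w = 0 ∧ lorentz v w = 0 := by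
  set Λ : LVec 3 →ₗ[ℝ] (Fin 3 → ℝ) := LinearMap.pi ![lorentzL t, lorentzL u, lorentzL v] with hΛ
  have hker : LinearMap.ker Λ ≠ ⊥ := LinearMap.ker_ne_bot_of_finrank_lt (by simp)
  obtain ⟨w, hw, hw0⟩ := Submodule.exists_mem_ne_zero_of_ne_bot hker
  rw [LinearMap.mem_ker] at hw
  have htw : lorentz t w = 0 := congrFun hw 0
  have huw : lorentz u w = 0 := congrFun hw 1
  have hvw : lorentz v w = 0 := congrFun hw 2
  have hpos := lorentz_self_pos_of_orthogonal ht hw0 htw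
  have hs : 0 < √(lorentz w w) := Real.sqrt_pos.2 hpos
  refine ⟨(√(lorentz w w))⁻¹ • w, ?_, ?_, ?_, ?_⟩
  · rw [lorentz_smul_left, lorentz_smul_right]
    have := Real.sq_sqrt hpos.le
    have := hs.ne'
    field_simp
    linarith
  all_goals rw [lorentz_smul_right]; simp [htw, huw, hvw]

theorem exists_polar (c d : ℝ) : ∃ ρ ψ : ℝ, 0 ≤ ρ ∧ c = ρ * Real.cos ψ ∧ d = ρ * Real.sin ψ := by
  refine ⟨‖(⟨c, d⟩ : ℂ)‖, Complex.arg ⟨c, d⟩, norm_nonneg _, ?_, ?_⟩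
  · rw [Complex.norm_mul_cos_arg]
  · rw [Complex.norm_mul_sin_arg]

/-- The frame of an axis whose orientation is such that the loxodromic expands `e₁`. -/
theorem exists_isAxisFrame_of_one_lt {A : GL (Fin (3 + 1)) ℝ} (hA : A ∈ SOup 3) {e₁ e₂ : LVec 3}
    (h₁ : e₁ ∈ futureNull 3) (h₂ : e₂ ∈ futureNull 3) (h₁₂ : lorentz e₁ e₂ < 0) {μ : ℝ}
    (hμ : 1 < μ) (hA₁ : act A e₁ = μ • e₁) (hA₂ : act A e₂ = μ⁻¹ • e₂) :
    ∃ (w₁ w₂ : LVec 3) (L θ : ℝ), 0 < L ∧ IsAxisFrame A e₁ e₂ w₁ w₂ L θ := by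
  have hμ0 : 0 < μ := by linarith
  have hiso : ∀ x y, lorentz (act A x) (act A y) = lorentz x y := hA.1.1
  have hdet : (A : Matrix (Fin (3 + 1)) (Fin (3 + 1)) ℝ).det = 1 := by
    have h := congrArg Units.val (MonoidHom.mem_ker.1 (show A ∈ MonoidHom.ker _ from hA.2))
    simpa using h
  have hfut : e₁ + e₂ ∈ futureCone 3 := by
    refine ⟨?_, add_pos h₁.2 h₂.2⟩
    rw [lorentz_add_left, lorentz_add_right, lorentz_add_right, h₁.1, h₂.1, lorentz_comm e₂ e₁]
    linarith
  obtain ⟨w₁, w11, ht1, e1w1, -⟩ := exists_unit_orthogonal (u := e₁) (v := e₁) hfut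
  have e2w1 : lorentz e₂ w₁ = 0 := by rw [lorentz_add_left] at ht1; linarith
  obtain ⟨w₂, w22, ht2, e1w2, w12⟩ := exists_unit_orthogonal (u := e₁) (v := w₁) hfut
  have e2w2 : lorentz e₂ w₂ = 0 := by rw [lorentz_add_left] at ht2; linarith
  set v : Fin 4 → LVec 3 := ![e₁, e₂, w₁, w₂] with hv
  have hind : LinearIndependent ℝ v := by
    rw [Fintype.linearIndependent_iff]
    intro g hg
    rw [Fin.sum_univ_four] at hg
    simp only [hv, Matrix.cons_val] at hg
    have key : ∀ u, g 0 * lorentz u e₁ + g 1 * lorentz u e₂ + g 2 * lorentz u w₁ +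
        g 3 * lorentz u w₂ = 0 := by
      intro u
      have := congrArg (lorentz u) hg
      simp only [lorentz_add_right, lorentz_smul_right] at this
      rw [this]
      exact map_zero (lorentzL u)
    have k1 := key e₁
    have k2 := key e₂
    have k3 := key w₁
    have k4 := key w₂
    simp only [h₁.1, h₂.1, e1w1, e2w1, e1w2, e2w2, w11, w22, w12, lorentz_comm w₁ e₁,
      lorentz_comm w₁ e₂, lorentz_comm w₂ e₁, lorentz_comm w₂ e₂, lorentz_comm w₂ w₁,
      lorentz_comm e₂ e₁, mul_zero, mul_one, zero_add, add_zero] at k1 k2 k3 k4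
    intro i
    fin_cases i
    · exact (mul_eq_zero.1 k2).resolve_right h₁₂.ne
    · exact (mul_eq_zero.1 k1).resolve_right h₁₂.ne
    · exact k3
    · exact k4
  let B := basisOfLinearIndependentOfCardEqFinrank hind (by simp)
  have hB : ∀ i, B i = v i := fun i => by simp [B]
  have hcoord : ∀ x : LVec 3, ∃ a b c d : ℝ, x = a • e₁ + b • e₂ + c • w₁ + d • w₂ := by
    intro x
    refine ⟨B.repr x 0, B.repr x 1, B.repr x 2, B.repr x 3, ?_⟩
    conv_lhs => rw [← B.sum_repr x, Fin.sum_univ_four]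
    simp [hB, hv]
  -- the orthogonal complement of the axis is invariant
  have hinv : ∀ w, lorentz e₁ w = 0 → lorentz e₂ w = 0 → ∃ c d : ℝ, act A w = c • w₁ + d • w₂ := by
    intro w hw1 hw2
    obtain ⟨a, b, c, d, h⟩ := hcoord (act A w)
    have k1 := hiso e₁ w
    have k2 := hiso e₂ w
    rw [hA₁, lorentz_smul_left, h, hw1] at k1
    rw [hA₂, lorentz_smul_left, h, hw2] at k2
    have k1' := (mul_eq_zero.1 k1).resolve_left hμ0.ne'
    have k2' := (mul_eq_zero.1 k2).resolve_left (inv_ne_zero hμ0.ne')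
    simp only [lorentz_add_right, lorentz_smul_right, h₁.1, h₂.1, e1w1, e2w1, e1w2, e2w2,
      lorentz_comm e₂ e₁, mul_zero, zero_add, add_zero] at k1' k2'
    have hb := (mul_eq_zero.1 k1').resolve_right h₁₂.ne
    have ha := (mul_eq_zero.1 k2').resolve_right h₁₂.ne
    exact ⟨c, d, by rw [h, ha, hb]; simp⟩
  obtain ⟨p, q, hpq⟩ := hinv w₁ e1w1 e2w1
  obtain ⟨r, t, hrt⟩ := hinv w₂ e1w2 e2w2
  have i11 := hiso w₁ w₁
  have i12 := hiso w₁ w₂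
  rw [hpq] at i11 i12
  rw [hrt] at i12
  simp only [lorentz_add_left, lorentz_add_right, lorentz_smul_left, lorentz_smul_right, w11, w22,
    w12, lorentz_comm w₂ w₁, mul_one, mul_zero, add_zero, zero_add] at i11 i12
  have hdet' : p * t - r * q = 1 := by
    let M : Matrix (Fin 4) (Fin 4) ℝ := !![μ, 0, 0, 0; 0, μ⁻¹, 0, 0; 0, 0, p, r; 0, 0, q, t]
    have hM : Matrix.toLin B B M = Matrix.toLin' (A : Matrix (Fin (3 + 1)) (Fin (3 + 1)) ℝ) := by
      refine B.ext fun j => ?_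
      rw [Matrix.toLin_self, Fin.sum_univ_four, Matrix.toLin'_apply]
      simp only [hB]
      change _ = act A (v j)
      fin_cases j <;> simp [hv, M, hA₁, hA₂, hpq, hrt]
    have h1 : LinearMap.det (Matrix.toLin B B M) = 1 := by rw [hM, LinearMap.det_toLin', hdet]
    rw [LinearMap.det_toLin] at h1
    simp only [M, Matrix.det_succ_row_zero, Fin.sum_univ_succ] at h1
    simp [Fin.succAbove, Matrix.submatrix] at h1
    field_simp at h1
    linarith
  have ht : t = p := by linear_combination p * hdet' + q * i12 - t * i11
  have hr : r = -q := by linear_combination p * i12 - q * hdet' - r * i11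
  obtain ⟨ρ, θ, hρ, hp, hq⟩ := exists_polar p q
  have hρ1 : ρ = 1 := by
    have : ρ ^ 2 = 1 := by
      rw [hp, hq] at i11
      linear_combination i11 - ρ ^ 2 * Real.sin_sq_add_cos_sq θ
    exact (pow_eq_one_iff_of_nonneg hρ two_ne_zero).1 this
  rw [hρ1, one_mul] at hp hq
  refine ⟨w₁, w₂, Real.log μ, θ, Real.log_pos hμ, ⟨h₁, h₂, h₁₂, e1w1, e1w2, e2w1, e2w2, w11, w22, w12,
    hcoord, ?_, ?_, ?_, ?_⟩⟩
  · rw [hA₁, Real.exp_log hμ0]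
  · rw [hA₂, Real.exp_neg, Real.exp_log hμ0]
  · rw [hpq, hp, hq]
  · rw [hrt, hr, ht, hp, hq]

theorem exists_isAxisFrame {A : GL (Fin (3 + 1)) ℝ} (hA : A ∈ SOup 3) (hlox : IsLoxodromic A) :
    ∃ (e₁ e₂ w₁ w₂ : LVec 3) (L θ : ℝ), 0 < L ∧ IsAxisFrame A e₁ e₂ w₁ w₂ L θ := by
  obtain ⟨hO, e₁, h₁, e₂, h₂, μ, hind, hμ1, hA₁, hA₂, -⟩ := hlox
  have h₁₂ := lorentz_neg_of_mem_futureNull h₁ h₂ hind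
  change act A e₁ = μ • e₁ at hA₁
  change act A e₂ = μ⁻¹ • e₂ at hA₂
  have hμ : 0 < μ := by
    have hfut : e₁ + e₂ ∈ futureCone 3 := by
      refine ⟨?_, add_pos h₁.2 h₂.2⟩
      rw [lorentz_add_left, lorentz_add_right, lorentz_add_right, h₁.1, h₂.1, lorentz_comm e₂ e₁]
      linarith
    have hAfut : act A (e₁ + e₂) ∈ futureCone 3 := (hO.2 _).2 hfut
    rw [act_add, hA₁, hA₂] at hAfut
    by_contra! h
    have hlast := hAfut.2
    have h' : μ⁻¹ ≤ 0 := inv_nonpos.2 h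
    simp only [Pi.add_apply, Pi.smul_apply, smul_eq_mul] at hlast
    nlinarith [h₁.2, h₂.2]
  rcases lt_or_gt_of_ne hμ1 with h | h
  · obtain ⟨w₁, w₂, L, θ, hL, hF⟩ := exists_isAxisFrame_of_one_lt hA h₂ h₁
      (by rwa [lorentz_comm]) (one_lt_inv₀ hμ |>.2 h) hA₂ (by rwa [inv_inv])
    exact ⟨e₂, e₁, w₁, w₂, L, θ, hL, hF⟩
  · obtain ⟨w₁, w₂, L, θ, hL, hF⟩ := exists_isAxisFrame_of_one_lt hA h₁ h₂ h₁₂ h hA₁ hA₂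
    exact ⟨e₁, e₂, w₁, w₂, L, θ, hL, hF⟩

end Frame

/-! ### The orbit of a point under a loxodromic -/

section Orbit

/-- The point of the helix through the orbit, at the real time `t`. -/
noncomputable def helix (e₁ e₂ w₁ w₂ : LVec 3) (L θ a b ρ ψ t : ℝ) : LVec 3 :=
  (a * Real.exp (L * t)) • e₁ + (b * Real.exp (-(L * t))) • e₂ +
    (ρ * Real.cos (t * θ + ψ)) • w₁ + (ρ * Real.sin (t * θ + ψ)) • w₂

variable {A : GL (Fin (3 + 1)) ℝ} {e₁ e₂ w₁ w₂ : LVec 3} {L θ : ℝ}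

namespace IsAxisFrame

theorem exists_helix (hF : IsAxisFrame A e₁ e₂ w₁ w₂ L θ) {x : LVec 3} (hx : x ∈ Hyp 3) :
    ∃ a b ρ ψ : ℝ, 0 < a ∧ 0 < b ∧ 0 ≤ ρ ∧ ρ ^ 2 = -2 * a * b * lorentz e₁ e₂ - 1 ∧
      x = helix e₁ e₂ w₁ w₂ L θ a b ρ ψ 0 := by
  obtain ⟨a, b, c, d, hxeq⟩ := hF.exists_coord x
  obtain ⟨ρ, ψ, hρ, hc, hd⟩ := exists_polar c d
  have hx1 := lorentz_neg_of_mem_futureCone (mem_futureCone_of_mem_Hyp hx) hF.e₁_mem.1.le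
    hF.e₁_mem.2
  have hx2 := lorentz_neg_of_mem_futureCone (mem_futureCone_of_mem_Hyp hx) hF.e₂_mem.1.le
    hF.e₂_mem.2
  have hxx := hx.1
  have e21 := lorentz_comm e₂ e₁
  have w1e1 := lorentz_comm w₁ e₁
  have w1e2 := lorentz_comm w₁ e₂
  have w2e1 := lorentz_comm w₂ e₁
  have w2e2 := lorentz_comm w₂ e₂
  have w21 := lorentz_comm w₂ w₁
  rw [hxeq] at hx1 hx2 hxx
  simp only [lorentz_add_left, lorentz_add_right, lorentz_smul_left, lorentz_smul_right,
    hF.e₁_mem.1, hF.e₂_mem.1, hF.e₁_w₁, hF.e₁_w₂, hF.e₂_w₁, hF.e₂_w₂, hF.w₁_w₁, hF.w₂_w₂, hF.w₁_w₂,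
    e21, w1e1, w1e2, w2e1, w2e2, w21, mul_zero, add_zero, zero_add, mul_one] at hx1 hx2 hxx
  refine ⟨a, b, ρ, ψ, ?_, ?_, hρ, ?_, ?_⟩
  · exact pos_of_mul_neg_left hx2 hF.e₁_e₂.le
  · exact pos_of_mul_neg_left hx1 hF.e₁_e₂.le
  · rw [hc, hd] at hxx
    linear_combination hxx - ρ ^ 2 * Real.sin_sq_add_cos_sq ψ
  · rw [hxeq, helix, hc, hd]
    simp

theorem act_helix (hF : IsAxisFrame A e₁ e₂ w₁ w₂ L θ) (a b ρ ψ t : ℝ) :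
    act A (helix e₁ e₂ w₁ w₂ L θ a b ρ ψ t) = helix e₁ e₂ w₁ w₂ L θ a b ρ ψ (t + 1) := by
  have h1 : Real.exp (L * (t + 1)) = Real.exp (L * t) * Real.exp L := by
    rw [← Real.exp_add]; ring_nf
  have h2 : Real.exp (-(L * (t + 1))) = Real.exp (-(L * t)) * Real.exp (-L) := by
    rw [← Real.exp_add]; ring_nf
  have h3 : (t + 1) * θ + ψ = (t * θ + ψ) + θ := by ring
  simp only [helix, act_add, act_smul, hF.act_e₁, hF.act_e₂, hF.act_w₁, hF.act_w₂, h1, h2, h3,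
    Real.cos_add (t * θ + ψ), Real.sin_add (t * θ + ψ)]
  match_scalars <;> ring

theorem act_zpow_helix (hF : IsAxisFrame A e₁ e₂ w₁ w₂ L θ) (a b ρ ψ : ℝ) (k : ℤ) :
    act (A ^ k) (helix e₁ e₂ w₁ w₂ L θ a b ρ ψ 0) = helix e₁ e₂ w₁ w₂ L θ a b ρ ψ k := by
  induction k with
  | zero => simp [act_one]
  | succ i ih =>
    rw [add_comm (i : ℤ) 1, zpow_one_add, act_mul, ih, hF.act_helix]
    push_cast
    rw [add_comm (1 : ℝ)]
  | pred i ih =>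
    apply act_injective A
    rw [← act_mul, ← zpow_one_add, hF.act_helix,
      show (1 : ℤ) + (-(i : ℤ) - 1) = -(i : ℤ) by ring, ih]
    congr 1
    push_cast
    ring

theorem lorentz_helix_helix (hF : IsAxisFrame A e₁ e₂ w₁ w₂ L θ) (a b ρ ψ a' b' ρ' ψ' t : ℝ) :
    -lorentz (helix e₁ e₂ w₁ w₂ L θ a b ρ ψ t) (helix e₁ e₂ w₁ w₂ L θ a' b' ρ' ψ' 0) =
      -lorentz e₁ e₂ * a * b' * Real.exp (L * t) + -lorentz e₁ e₂ * a' * b * Real.exp (-(L * t)) -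
        ρ * ρ' * Real.cos (t * θ + (ψ - ψ')) := by
  have h3 : t * θ + (ψ - ψ') = (t * θ + ψ) - ψ' := by ring
  rw [h3, Real.cos_sub]
  simp only [helix, lorentz_add_left, lorentz_add_right, lorentz_smul_left, lorentz_smul_right,
    hF.e₁_mem.1, hF.e₂_mem.1, hF.e₁_w₁, hF.e₁_w₂, hF.e₂_w₁, hF.e₂_w₂, hF.w₁_w₁, hF.w₂_w₂, hF.w₁_w₂,
    lorentz_comm e₂ e₁, lorentz_comm w₁ e₁, lorentz_comm w₁ e₂, lorentz_comm w₂ e₁,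
    lorentz_comm w₂ e₂, lorentz_comm w₂ w₁, mul_zero, zero_mul, Real.exp_zero, zero_add, neg_zero]
  ring

theorem lorentz_helix_e₁ (hF : IsAxisFrame A e₁ e₂ w₁ w₂ L θ) (a b ρ ψ t : ℝ) :
    lorentz e₁ (helix e₁ e₂ w₁ w₂ L θ a b ρ ψ t) = b * lorentz e₁ e₂ * Real.exp (-(L * t)) := by
  simp only [helix, lorentz_add_right, lorentz_smul_right, hF.e₁_mem.1, hF.e₁_w₁, hF.e₁_w₂]
  ring

theorem lorentz_helix_e₂ (hF : IsAxisFrame A e₁ e₂ w₁ w₂ L θ) (a b ρ ψ t : ℝ) :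
    lorentz e₂ (helix e₁ e₂ w₁ w₂ L θ a b ρ ψ t) = a * lorentz e₁ e₂ * Real.exp (L * t) := by
  simp only [helix, lorentz_add_right, lorentz_smul_right, hF.e₂_mem.1, hF.e₂_w₁, hF.e₂_w₂,
    lorentz_comm e₂ e₁]
  ring

/-- The distances of a point from the points of an orbit are given by a profile whose oscillating
part is strictly dominated by the other one. -/
theorem exists_profile (hF : IsAxisFrame A e₁ e₂ w₁ w₂ L θ) {x p : LVec 3} (hx : x ∈ Hyp 3)
    (hp : p ∈ Hyp 3) : ∃ b C γ φ : ℝ, 0 ≤ γ ∧ γ < C ∧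
      ∀ k : ℤ, lorentz (act (A ^ k) x) p = -profile L b C γ θ φ k := by
  obtain ⟨a, b, ρ, ψ, ha, hb, hρ, hρ2, hxeq⟩ := hF.exists_helix hx
  obtain ⟨a', b', ρ', ψ', ha', hb', hρ', hρ2', hpeq⟩ := hF.exists_helix hp
  set s := -lorentz e₁ e₂ with hs
  have hs0 : 0 < s := neg_pos.2 hF.e₁_e₂
  -- both exponential coefficients are written as exponentials
  set P := Real.log (s * a * b')
  set Q := Real.log (s * a' * b)
  have hP : Real.exp P = s * a * b' := Real.exp_log (by positivity)
  have hQ : Real.exp Q = s * a' * b := Real.exp_log (by positivity)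
  refine ⟨(Q - P) / 2, 2 * Real.exp ((P + Q) / 2), ρ * ρ', ψ - ψ', by positivity, ?_, fun k => ?_⟩
  · refine lt_of_pow_lt_pow_left₀ 2 (by positivity) ?_
    have e : (2 * Real.exp ((P + Q) / 2)) ^ 2 = 4 * (Real.exp P * Real.exp Q) := by
      rw [mul_pow, ← Real.exp_nat_mul, ← Real.exp_add]
      norm_num
      ring
    have q1 : ρ ^ 2 = 2 * a * b * s - 1 := by rw [hρ2, hs]; ring
    have q2 : ρ' ^ 2 = 2 * a' * b' * s - 1 := by rw [hρ2', hs]; ring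
    have n1 := sq_nonneg ρ
    have n2 := sq_nonneg ρ'
    rw [e, hP, hQ, mul_pow]
    rw [q1] at n1 ⊢
    rw [q2] at n2 ⊢
    nlinarith
  · rw [hxeq, hpeq, hF.act_zpow_helix, eq_neg_iff_add_eq_zero, ← neg_eq_zero, neg_add,
      hF.lorentz_helix_helix, ← hs, ← hP, ← hQ, profile, Real.cosh_eq]
    have e1 : Real.exp ((P + Q) / 2) * Real.exp (L * k - (Q - P) / 2) =
        Real.exp P * Real.exp (L * k) := by
      rw [← Real.exp_add, ← Real.exp_add]; ring_nf
    have e2 : Real.exp ((P + Q) / 2) * Real.exp (-(L * k - (Q - P) / 2)) =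
        Real.exp Q * Real.exp (-(L * k)) := by
      rw [← Real.exp_add, ← Real.exp_add]; ring_nf
    linear_combination -e1 - e2

end IsAxisFrame

/-- An orbit point can be nearer to `p` than both of its neighbours only if its height along the
axis differs by a bounded amount from that of `p`; then all distant orbit points are farther. -/
theorem exists_profile_bound (hL : 0 < L) : ∃ K : ℕ, 0 < K ∧ ∀ b C γ φ : ℝ, 0 ≤ γ → γ < C → ∀ i : ℤ,
    profile L b C γ θ φ i ≤ profile L b C γ θ φ (i + 1) →
    profile L b C γ θ φ i ≤ profile L b C γ θ φ (i - 1) →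
    ∀ j : ℤ, (K : ℤ) < |j - i| → profile L b C γ θ φ i < profile L b C γ θ φ j := by
  have hsL : 0 < Real.sinh (L / 2) := Real.sinh_pos_iff.2 (by linarith)
  set B := L / 2 + Real.arsinh (1 / Real.sinh (L / 2)) with hB
  have hB0 : 0 ≤ B := by
    have : 0 ≤ Real.arsinh (1 / Real.sinh (L / 2)) := Real.arsinh_nonneg_iff.2 (by positivity)
    linarith
  refine ⟨⌈(2 * B + 6) / L⌉₊, Nat.ceil_pos.2 (by positivity), ?_⟩
  intro b C γ φ hγ hγC i h1 h2 j hj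
  have hC : 0 < C := hγ.trans_lt hγC
  have hosc : ∀ k : ℤ, |profile L b C γ θ φ k - C * Real.cosh (L * k - b)| ≤ C := by
    intro k
    rw [profile, sub_sub_cancel_left, abs_neg, abs_mul, abs_of_nonneg hγ]
    nlinarith [Real.abs_cos_le_one (k * θ + φ), abs_nonneg (Real.cos (k * θ + φ))]
  have hcosh : ∀ k l : ℤ, profile L b C γ θ φ k ≤ profile L b C γ θ φ l →
      Real.cosh (L * k - b) ≤ Real.cosh (L * l - b) + 2 := by
    intro k l h
    have hk := abs_le.1 (hosc k)
    have hl := abs_le.1 (hosc l)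
    refine le_of_mul_le_mul_left ?_ hC
    linarith [hk.1, hl.2]
  set t := L * i - b with ht
  have hdiff : ∀ r : ℝ, Real.cosh (r + L / 2) - Real.cosh (r - L / 2) =
      2 * (Real.sinh r * Real.sinh (L / 2)) := by
    intro r
    rw [Real.cosh_add, Real.cosh_sub]
    ring
  have hone : ∀ r : ℝ, Real.cosh (r + L / 2) ≤ Real.cosh (r - L / 2) + 2 → r + L / 2 ≤ B := by
    intro r hr
    have : Real.sinh r * Real.sinh (L / 2) ≤ 1 := by linarith [hdiff r]
    rw [← le_div_iff₀ hsL, ← Real.arsinh_le_arsinh, Real.arsinh_sinh] at this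
    linarith
  have ht1 : t ≤ B := by
    have := hcosh i (i - 1) h2
    have h3 := hone (t - L / 2) (by
      rw [sub_add_cancel]
      refine this.trans (le_of_eq ?_)
      congr 2
      push_cast
      rw [ht]; ring)
    linarith
  have ht2 : -t ≤ B := by
    have := hcosh i (i + 1) h1
    have h3 := hone (-t - L / 2) (by
      rw [sub_add_cancel, Real.cosh_neg]
      refine this.trans (le_of_eq ?_)
      rw [← Real.cosh_neg (-t - L / 2 - L / 2)]
      congr 2
      push_cast
      rw [ht]; ring)
    linarith
  have htB : |t| ≤ B := abs_le.2 ⟨by linarith, ht1⟩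
  by_contra! hle
  have hc := hcosh j i hle
  have hj' : 2 * B + 6 < L * |((j - i : ℤ) : ℝ)| := by
    have h3 : ((⌈(2 * B + 6) / L⌉₊ : ℕ) : ℝ) < |((j - i : ℤ) : ℝ)| := by exact_mod_cast hj
    have h4 := Nat.le_ceil ((2 * B + 6) / L)
    rw [div_le_iff₀ hL] at h4
    nlinarith
  have hfar : B + 6 ≤ |L * j - b| := by
    have e : L * ((j - i : ℤ) : ℝ) = (L * j - b) - t := by push_cast; rw [ht]; ring
    have h5 : L * |((j - i : ℤ) : ℝ)| = |(L * j - b) - t| := by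
      rw [← e, abs_mul, abs_of_pos hL]
    have h6 := abs_sub (L * j - b) t
    linarith
  have g1 : Real.cosh (B + 6) ≤ Real.cosh (L * j - b) :=
    Real.cosh_le_cosh.2 (by rwa [abs_of_nonneg (by linarith)])
  have g2 : Real.cosh t ≤ Real.cosh B := Real.cosh_le_cosh.2 (by rwa [abs_of_nonneg hB0])
  have g3 : 3 < Real.cosh 6 := by
    rw [Real.cosh_eq]
    have := Real.add_one_le_exp (6 : ℝ)
    have := Real.exp_pos (-6 : ℝ)
    linarith
  have g4 := Real.one_le_cosh B
  rw [Real.cosh_add] at g1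
  have g5 : 0 ≤ Real.sinh B * Real.sinh 6 :=
    mul_nonneg (Real.sinh_nonneg_iff.2 hB0) (Real.sinh_nonneg_iff.2 (by norm_num))
  nlinarith

namespace IsAxisFrame

variable {x : LVec 3}

theorem mem_nearest_iff {p : LVec 3} {b C γ φ : ℝ}
    (hprof : ∀ k : ℤ, lorentz (act (A ^ k) x) p = -profile L b C γ θ φ k) (k : ℤ) :
    k ∈ nearest (fun k : ℤ => act (A ^ k) x) p ↔
      ∀ j, profile L b C γ θ φ k ≤ profile L b C γ θ φ j := by
  simp only [nearest, Set.mem_ofPred_eq, hprof, neg_le_neg_iff]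

theorem orbit_injective (hF : IsAxisFrame A e₁ e₂ w₁ w₂ L θ) (hL : 0 < L) (hx : x ∈ Hyp 3) :
    Function.Injective fun k : ℤ => act (A ^ k) x := by
  obtain ⟨a, b, ρ, ψ, ha, hb, hρ, hρ2, rfl⟩ := hF.exists_helix hx
  intro k l hkl
  have := congrArg (lorentz e₂) hkl
  simp only [hF.act_zpow_helix, hF.lorentz_helix_e₂] at this
  have := Real.exp_injective (mul_left_cancel₀ (mul_ne_zero ha.ne' hF.e₁_e₂.ne) this)
  exact_mod_cast mul_left_cancel₀ hL.ne' this

theorem finitelyDetermined_orbit (hF : IsAxisFrame A e₁ e₂ w₁ w₂ L θ) (hL : 0 < L)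
    (hx : x ∈ Hyp 3) : FinitelyDetermined fun k : ℤ => act (A ^ k) x := by
  obtain ⟨K, hK0, hK⟩ := exists_profile_bound (θ := θ) hL
  intro i
  refine ⟨Finset.Icc (i - K) (i + K), fun p hp hle k hk hki => ?_⟩
  obtain ⟨b, C, γ, φ, hγ, hγC, hprof⟩ := hF.exists_profile hx hp
  simp only [hprof, neg_le_neg_iff, neg_lt_neg_iff, Finset.mem_Icc] at hle hk ⊢
  refine hK b C γ φ hγ hγC i (hle _ (by omega)) (hle _ (by omega)) k ?_
  rw [lt_abs]
  omega

theorem linearIndepOn_nearest (hF : IsAxisFrame A e₁ e₂ w₁ w₂ L θ) (hL : 0 < L) (hx : x ∈ Hyp 3)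
    (hy : ∀ k : ℤ, act (A ^ k) x ∈ Hyp 3) {p : LVec 3} (hp : p ∈ Hyp 3) :
    LinearIndepOn ℝ (fun k : ℤ => act (A ^ k) x) (nearest (fun k : ℤ => act (A ^ k) x) p) := by
  obtain ⟨b, C, γ, φ, hγ, hγC, hprof⟩ := hF.exists_profile hx hp
  rw [linearIndepOn_iff']
  intro s d hs hd
  -- translates of the relation, paired with any vector
  have hrel : ∀ (j : ℤ) (u : LVec 3), ∑ k ∈ s, d k * lorentz (act (A ^ (k + j)) x) u = 0 := by
    intro j u
    have h1 : ∑ k ∈ s, d k • act (A ^ (k + j)) x = 0 := by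
      have h2 := congrArg (Matrix.mulVecLin ((A ^ j : GL (Fin (3 + 1)) ℝ) :
        Matrix (Fin (3 + 1)) (Fin (3 + 1)) ℝ)) hd
      rw [map_sum, map_zero] at h2
      rw [← h2]
      refine Finset.sum_congr rfl fun k _ => ?_
      rw [map_smul, Matrix.mulVecLin_apply, add_comm k j, zpow_add, act_mul]
      rfl
    have h3 := congrArg (lorentzL u) h1
    rw [map_sum, map_zero] at h3
    rw [← h3]
    refine Finset.sum_congr rfl fun k _ => ?_
    rw [map_smul, lorentzL_apply, lorentz_comm, smul_eq_mul]
  have hmin : ∀ k ∈ s, ∀ j, profile L b C γ θ φ k ≤ profile L b C γ θ φ j :=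
    fun k hk => (mem_nearest_iff hprof k).1 (hs hk)
  have hf : ∀ j : ℤ, ∑ k ∈ s, d k * profile L b C γ θ φ (k + j) = 0 := by
    intro j
    have := hrel j p
    simp only [hprof, mul_neg, Finset.sum_neg_distrib, neg_eq_zero] at this
    exact this
  have h0 : ∑ k ∈ s, d k = 0 := by
    rcases s.eq_empty_or_nonempty with rfl | ⟨k₀, hk₀⟩
    · simp
    have h1 := hf 0
    have h2 : ∀ k ∈ s, d k * profile L b C γ θ φ (k + 0) = d k * profile L b C γ θ φ k₀ := by
      intro k hk
      rw [add_zero, le_antisymm (hmin k hk k₀) (hmin k₀ hk₀ k)]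
    rw [Finset.sum_congr rfl h2, ← Finset.sum_mul] at h1
    refine (mul_eq_zero.1 h1).resolve_right ?_
    have h3 := lorentz_le_neg_one (hy k₀) hp
    rw [hprof] at h3
    linarith
  obtain ⟨a, b', ρ, ψ, ha, hb, hρ, hρ2, rfl⟩ := hF.exists_helix hx
  have he₁ := hrel 0 e₁
  have he₂ := hrel 0 e₂
  have hpull : ∀ (c : ℝ) (w : ℤ → ℝ), c ≠ 0 → ∑ k ∈ s, d k * (c * w k) = 0 →
      ∑ k ∈ s, d k * w k = 0 := by
    intro c w hc h
    refine (mul_eq_zero.1 ?_).resolve_left hc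
    rw [Finset.mul_sum, ← h]
    exact Finset.sum_congr rfl fun k _ => by ring
  simp only [add_zero, hF.act_zpow_helix, lorentz_comm _ e₁, hF.lorentz_helix_e₁] at he₁
  simp only [add_zero, hF.act_zpow_helix, lorentz_comm _ e₂, hF.lorentz_helix_e₂] at he₂
  rw [lorentz_comm e₂ e₁] at he₂
  exact eq_zero_of_relation hL hγC hγ s hmin d h0
    (hpull _ _ (mul_ne_zero ha.ne' hF.e₁_e₂.ne) he₂)
    (hpull _ _ (mul_ne_zero hb.ne' hF.e₁_e₂.ne) he₁) hf

end IsAxisFrame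

theorem act_mem_Hyp {n : ℕ} {B : GL (Fin (n + 1)) ℝ} (hB : B ∈ Oup n) {x : LVec n}
    (hx : x ∈ Hyp n) : act B x ∈ Hyp n :=
  ⟨(hB.1 x x).trans hx.1, ((hB.2 x).2 (mem_futureCone_of_mem_Hyp hx)).2⟩

end Orbit

theorem theorem6p1 (A : GL (Fin (3 + 1)) ℝ) (hA : A ∈ SOup 3) (hlox : IsLoxodromic A)
    (x : LVec 3) (hx : x ∈ Hyp 3) :
    IsSimpleComplex (dirichletComplex (Subgroup.zpowers A) x) := by
  obtain ⟨e₁, e₂, w₁, w₂, L, θ, hL, hF⟩ := exists_isAxisFrame hA hlox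
  have hy : ∀ k : ℤ, act (A ^ k) x ∈ Hyp 3 := fun k => act_mem_Hyp ((Oup 3).zpow_mem (show A ∈ Oup 3 from hA.1) k) hx
  have horbit : {y | ∃ γ ∈ Subgroup.zpowers A,
      y = (γ : Matrix (Fin (3 + 1)) (Fin (3 + 1)) ℝ).mulVec x} =
      Set.range fun k : ℤ => act (A ^ k) x := by
    ext y
    simp only [Set.mem_ofPred_eq, Subgroup.exists_mem_zpowers, Set.mem_range, act, eq_comm]
  rw [dirichletComplex, horbit]
  exact isSimpleComplex_voronoiComplex hy (hF.orbit_injective hL hx)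
    (hF.finitelyDetermined_orbit hL hx) fun p hp => hF.linearIndepOn_nearest hL hx hy hp
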